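/- Work over $\mathbb{C}$. Let $n\ge 2$ and $t\ge 3$, and let $R\cong\mathbb{P}^n$ be a hyperplane in $\mathbb{P}^{n+1}$. For points $p,q$ write $\langle p,q\rangle$ for their linear span. Call $(x_{ij})_{1\le i<j\le t}\in(\mathbb{P}^n)^{\binom t2}$ a configuration if $x_{bc}\in\langle x_{ab},x_{ac}\rangle$ for all $1\le a<b<c\le t$. Call a configuration nondegenerate if for all $a<b<c$ the points $x_{ab},x_{ac},x_{bc}$ are pairwise distinct, so that they lie on a unique line $l_{abc}$, and for all $a<b<c<d$ the lines $l_{abc}$ and $l_{bcd}$ (which meet at $x_{bc}$) are distinct, so that they span a plane. Let $W_{n,t}\subset(\mathbb{P}^n)^{\binom t2}$ be the Zariski closure of the set of nondegenerate configurations. Sending $(p_1,\dots,p_t)$ to $(x_{ij})_{1\le i<j\le t}$, where $x_{ij}$ is the point in which the line $\langle p_i,p_j\rangle$ meets $R$, defines a rational map $$\pi_{n,t}:(\mathbb{P}^{n+1})^t\dashrightarrow W_{n,t}\subset(\mathbb{P}^n)^{\binom t2}.$$ More precisely, it is defined on the dense open set of all $(p_1,\dots,p_t)$ such that the $p_i$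 are pairwise distinct and no line $\langle p_i,p_j\rangle$ is contained in $R$; there it is continuous for the Zariski topologies and takes values in $W_{n,t}$. Then $\pi_{n,t}$ is dominant onto $W_{n,t}$, that is, its image is Zariski dense in $W_{n,t}$. Its general fibre has dimension $n+2$: there is a dense open subset of $W_{n,t}$ such that the fibre of $\pi_{n,t}$ over each of its points has dimension $n+2$. -/

import Mathlib

open scoped LinearAlgebra.Projectivization

namespace Lift

/-- The multiprojective space `(ℙ^m)^ι` over `ℂ`. -/
def MultiProj (ι : Type) (m : ℕ) : Type := ι → ℙ ℂ (Fin (m + 1) → ℂ)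

/-- A polynomial in the homogeneous coordinates `X (i, k)`, where `i : ι` and `k = 0, …, m`, is
multihomogeneous of multidegree `d` if each of its monomials has degree `d i` in the `i`-th group
of variables. -/
def IsMultihomogeneous {ι : Type} {m : ℕ} (F : MvPolynomial (ι × Fin (m + 1)) ℂ) (d : ι → ℕ) :
    Prop :=
  ∀ s ∈ F.support, ∀ i, ∑ k, s (i, k) = d i

/-- The points where `F` does not vanish. For multihomogeneous `F` this does not depend on the
representatives of the points. -/
noncomputable def nonvanishing {ι : Type} {m : ℕ} (F : MvPolynomial (ι × Fin (m + 1)) ℂ) :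
    Set (MultiProj ι m) :=
  {p | MvPolynomial.eval (fun v => (p v.1).rep v.2) F ≠ 0}

/-- The Zariski topology on `(ℙ^m)^ι`: the non-vanishing loci of multihomogeneous polynomials form
a basis of open sets, so the closed sets are the common zero loci of families of multihomogeneous
polynomials. -/
noncomputable instance zariski (ι : Type) (m : ℕ) : TopologicalSpace (MultiProj ι m) :=
  TopologicalSpace.generateFrom
    {U | ∃ (F : MvPolynomial (ι × Fin (m + 1)) ℂ) (d : ι → ℕ),
      IsMultihomogeneous F d ∧ U = nonvanishing F}

/-- Pairs of indices `i < j`. -/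
abbrev Pairs (t : ℕ) : Type := {q : Fin t × Fin t // q.1 < q.2}

/-- The pair `(i, j)` with `i < j`. -/
abbrev pr {t : ℕ} {i j : Fin t} (h : i < j) : Pairs t := ⟨(i, j), h⟩

/-- The linear span `⟨p, q⟩` of two points, as a linear subspace of the underlying vector space.
It is the line joining `p` and `q` if they are distinct, and the point `p` if `p = q`. -/
noncomputable def join {V : Type} [AddCommGroup V] [Module ℂ V] (p q : ℙ ℂ V) : Submodule ℂ V :=
  p.submodule ⊔ q.submodule

/-- All configurations `(x_ij)_{i<j}` of points of `ℙ^n` such that `x_bc ∈ ⟨x_ab, x_ac⟩` for all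
`a < b < c`. -/
def configurations (n t : ℕ) : Set (MultiProj (Pairs t) n) :=
  {x | ∀ (a b c : Fin t) (hab : a < b) (hbc : b < c),
    (x (pr hbc)).submodule ≤ join (x (pr hab)) (x (pr (hab.trans hbc)))}

/-- Nondegenerate configurations: for `a < b < c` the three points `x_ab, x_ac, x_bc` are pairwise
distinct (so they determine a line `l_abc`), and for `a < b < c < d` the lines `l_abc` and `l_bcd`
(which meet at `x_bc`) are distinct, so that they span a plane. -/
def nondegenerate (n t : ℕ) : Set (MultiProj (Pairs t) n) :=
  {x | (∀ (a b c : Fin t) (hab : a < b) (hbc : b < c),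
      x (pr hab) ≠ x (pr (hab.trans hbc)) ∧ x (pr hab) ≠ x (pr hbc) ∧
        x (pr (hab.trans hbc)) ≠ x (pr hbc)) ∧
    ∀ (a b c d : Fin t) (hab : a < b) (hbc : b < c) (hcd : c < d),
      join (x (pr hab)) (x (pr (hab.trans hbc))) ≠ join (x (pr hbc)) (x (pr (hbc.trans hcd)))}

/-- The variety `W_{n,t}`: the Zariski closure of the set of nondegenerate configurations. -/
def W (n t : ℕ) : Set (MultiProj (Pairs t) n) :=
  closure (configurations n t ∩ nondegenerate n t)

/-- A linear embedding `φ` of `ℂ^(n+1)` into `ℂ^(n+2)` identifies `ℙ^n` with a hyperplane `R` of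
`ℙ^(n+1)`. The intersections of `R` with the lines `⟨p_i, p_j⟩` make sense where the `p_i` are
distinct and none of these lines is contained in `R`. -/
def domain {n : ℕ} (t : ℕ) (φ : (Fin (n + 1) → ℂ) →ₗ[ℂ] (Fin (n + 1 + 1) → ℂ)) :
    Set (MultiProj (Fin t) (n + 1)) :=
  {p | ∀ i j : Fin t, i < j → p i ≠ p j ∧ ¬ join (p i) (p j) ≤ LinearMap.range φ}

/-- The line joining two distinct points, if not contained in the hyperplane `R`, meets `R` in
exactly one point. -/
theorem existsUnique_section {n : ℕ} (φ : (Fin (n + 1) → ℂ) →ₗ[ℂ] (Fin (n + 1 + 1) → ℂ))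
    (hφ : Function.Injective φ) (p q : ℙ ℂ (Fin (n + 1 + 1) → ℂ)) (hpq : p ≠ q)
    (hR : ¬ join p q ≤ LinearMap.range φ) :
    ∃! x : ℙ ℂ (Fin (n + 1) → ℂ),
      x.submodule.map φ = join p q ⊓ LinearMap.range φ := by
  have h2 : Module.finrank ℂ (join p q) = 2 := by
    have hs := Submodule.finrank_sup_add_finrank_inf_eq p.submodule q.submodule
    have hi : p.submodule ⊓ q.submodule = ⊥ := by
      by_contra hne
      have h1 : 0 < Module.finrank ℂ ↥(p.submodule ⊓ q.submodule) :=
        Nat.pos_of_ne_zero fun h0 => hne (Submodule.finrank_eq_zero.mp h0)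
      have e1 : p.submodule ⊓ q.submodule = p.submodule :=
        Submodule.eq_of_le_of_finrank_le inf_le_left (by rw [p.finrank_submodule]; omega)
      have e2 : p.submodule ⊓ q.submodule = q.submodule :=
        Submodule.eq_of_le_of_finrank_le inf_le_right (by rw [q.finrank_submodule]; omega)
      exact hpq (Projectivization.submodule_injective (e1.symm.trans e2))
    rw [hi, p.finrank_submodule, q.finrank_submodule, finrank_bot, add_zero] at hs
    exact hs
  have hr : Module.finrank ℂ (LinearMap.range φ) = n + 1 := by
    rw [LinearMap.finrank_range_of_inj hφ]; simp
  have h1 : Module.finrank ℂ ↥(join p q ⊓ LinearMap.range φ) = 1 := by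
    have hs := Submodule.finrank_sup_add_finrank_inf_eq (join p q) (LinearMap.range φ)
    have hlt : Module.finrank ℂ (LinearMap.range φ) <
        Module.finrank ℂ ↥(join p q ⊔ LinearMap.range φ) := by
      apply Submodule.finrank_lt_finrank_of_lt
      exact lt_of_le_of_ne le_sup_right fun h => hR (h ▸ le_sup_left)
    have hle := Submodule.finrank_le (join p q ⊔ LinearMap.range φ)
    simp only [Module.finrank_fintype_fun_eq_card, Fintype.card_fin] at hle
    omega
  have hmap : ((join p q ⊓ LinearMap.range φ).comap φ).map φ = join p q ⊓ LinearMap.range φ := by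
    rw [Submodule.map_comap_eq, inf_comm, inf_assoc, inf_idem]
  have hc : Module.finrank ℂ ↥((join p q ⊓ LinearMap.range φ).comap φ) = 1 := by
    have e := LinearEquiv.finrank_eq
      (Submodule.equivMapOfInjective φ hφ ((join p q ⊓ LinearMap.range φ).comap φ))
    rw [hmap, h1] at e
    exact e
  refine ⟨Projectivization.mk'' _ hc, ?_, fun y hy => ?_⟩
  · simp only [Projectivization.submodule_mk'', hmap]
  · apply Projectivization.submodule_injective
    apply Submodule.map_injective_of_injective hφ
    rw [Projectivization.submodule_mk'', hmap]
    exact hy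

/-- The map `π_{n,t}` on its domain: it sends `(p_i)` to the points `x_ij` in which `R` meets the
lines `⟨p_i, p_j⟩`. -/
noncomputable def projMap {n t : ℕ} (φ : (Fin (n + 1) → ℂ) →ₗ[ℂ] (Fin (n + 1 + 1) → ℂ))
    (hφ : Function.Injective φ) (p : domain t φ) : MultiProj (Pairs t) n := fun q =>
  (existsUnique_section φ hφ (p.1 q.1.1) (p.1 q.1.2) (p.2 _ _ q.2).1 (p.2 _ _ q.2).2).choose

end Lift

/-! Split `ℂ^(n+2)` as `φ(ℂ^(n+1)) ⊕ ℂe`. A point off `R` is `[φ u + e]` for a unique vector `u`,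
and the line through `[φ u + e]` and `[φ v + e]` meets `R` in the direction `v - u`. Hence tuples
off `R` with image `x` are the same as lifts of `x`: vectors `w_i` such that `w_j - w_i` represents
`x_ij` (`IsLift`).

On the open set `generic`, every configuration has a lift (`exists_isLift`). It is built one index
at a time: closing one triangle fixes the new vector, and the other incidences hold because two
distinct lines meet in one point. Lifts are unique up to scaling and translation
(`IsLift.exists_eq`). No point of a fibre over `generic` lies in `R`, since otherwise two of the
`x_ij` would coincide. So such a fibre is `{y₀ ≠ 0}` in affine space of dimension `n + 2`: one
coordinate for the scale and `n + 1` for the translation. The chart is shown to be a topological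
embedding, and the Krull dimension is computed from it.

Existence of lifts puts all generic configurations in the image, which gives dominance. Conversely,
the domain is irreducible and the preimage of `generic` is open and, by the moment curve, nonempty.
It is therefore dense, and continuity puts the whole image in `W`. -/

namespace Lift

/-! ### Multihomogeneous forms and the Zariski topology on products of projective spaces. -/

open MvPolynomial

/-- The multidegree of a homogeneous coordinate. -/
def multiweight {ι : Type} [DecidableEq ι] (m : ℕ) : ι × Fin (m + 1) → (ι → ℕ) :=
  fun a => Pi.single a.1 1

theorem weight_multiweight {ι : Type} [Fintype ι] [DecidableEq ι] {m : ℕ}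
    (s : ι × Fin (m + 1) →₀ ℕ) (i : ι) :
    Finsupp.weight (multiweight m) s i = ∑ k, s (i, k) := by
  rw [Finsupp.weight_eq_sum, Finset.sum_apply, Fintype.sum_prod_type]
  rw [Finset.sum_eq_single i]
  · simp [multiweight]
  · intro j _ hj
    simp [multiweight, hj.symm]
  · simp

theorem isMultihomogeneous_iff {ι : Type} [Fintype ι] [DecidableEq ι] {m : ℕ}
    (F : MvPolynomial (ι × Fin (m + 1)) ℂ) (d : ι → ℕ) :
    IsMultihomogeneous F d ↔ IsWeightedHomogeneous (multiweight m) F d := by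
  simp only [IsMultihomogeneous, IsWeightedHomogeneous, mem_support_iff, funext_iff,
    weight_multiweight]

/-- Functions of families of vectors which are given by a multihomogeneous polynomial. -/
def IsForm {ι : Type} {m : ℕ} (d : ι → ℕ) (g : (ι → Fin (m + 1) → ℂ) → ℂ) : Prop :=
  ∃ F : MvPolynomial (ι × Fin (m + 1)) ℂ, IsMultihomogeneous F d ∧
    ∀ v, eval (fun a => v a.1 a.2) F = g v

namespace IsForm

variable {ι : Type} [Fintype ι] [DecidableEq ι] {m : ℕ} {d e : ι → ℕ}
  {g h : (ι → Fin (m + 1) → ℂ) → ℂ}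

theorem mul (hg : IsForm d g) (hh : IsForm e h) : IsForm (d + e) (fun v => g v * h v) := by
  obtain ⟨F, hF, hFv⟩ := hg
  obtain ⟨G, hG, hGv⟩ := hh
  rw [isMultihomogeneous_iff] at hF hG
  exact ⟨F * G, (isMultihomogeneous_iff _ _).2 (hF.mul hG), fun v => by simp [hFv, hGv]⟩

theorem add (hg : IsForm d g) (hh : IsForm d h) : IsForm d (fun v => g v + h v) := by
  obtain ⟨F, hF, hFv⟩ := hg
  obtain ⟨G, hG, hGv⟩ := hh
  rw [isMultihomogeneous_iff] at hF hG
  exact ⟨F + G, (isMultihomogeneous_iff _ _).2 (hF.add hG), fun v => by simp [hFv, hGv]⟩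

theorem const_mul (c : ℂ) (hg : IsForm d g) : IsForm d (fun v => c * g v) := by
  obtain ⟨F, hF, hFv⟩ := hg
  rw [isMultihomogeneous_iff] at hF
  exact ⟨C c * F, (isMultihomogeneous_iff _ _).2 (hF.C_mul c), fun v => by simp [hFv]⟩

theorem sub (hg : IsForm d g) (hh : IsForm d h) : IsForm d (fun v => g v - h v) := by
  simpa [sub_eq_add_neg] using hg.add (hh.const_mul (-1))

theorem const (c : ℂ) : IsForm (0 : ι → ℕ) (fun _ : ι → Fin (m + 1) → ℂ => c) :=
  ⟨C c, (isMultihomogeneous_iff _ _).2 (isWeightedHomogeneous_C _ c), fun v => by simp⟩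

theorem sum {κ : Type*} (s : Finset κ) {g : κ → (ι → Fin (m + 1) → ℂ) → ℂ}
    (hg : ∀ k ∈ s, IsForm d (g k)) : IsForm d (fun v => ∑ k ∈ s, g k v) := by
  classical
  induction s using Finset.induction_on with
  | empty =>
    exact ⟨0, (isMultihomogeneous_iff _ _).2 (isWeightedHomogeneous_zero _ _ _), fun v => by simp⟩
  | insert a s ha ih =>
    simp only [Finset.sum_insert ha]
    exact (hg a (Finset.mem_insert_self a s)).add
      (ih fun k hk => hg k (Finset.mem_insert_of_mem hk))

theorem prod {κ : Type*} (s : Finset κ) {d : κ → ι → ℕ} {g : κ → (ι → Fin (m + 1) → ℂ) → ℂ}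
    (hg : ∀ k ∈ s, IsForm (d k) (g k)) :
    IsForm (∑ k ∈ s, d k) (fun v => ∏ k ∈ s, g k v) := by
  classical
  induction s using Finset.induction_on with
  | empty => simpa using const (ι := ι) (m := m) 1
  | insert a s ha ih =>
    simp only [Finset.prod_insert ha, Finset.sum_insert ha]
    exact (hg a (Finset.mem_insert_self a s)).mul
      (ih fun k hk => hg k (Finset.mem_insert_of_mem hk))

theorem pow (hg : IsForm d g) (n : ℕ) : IsForm (n • d) (fun v => g v ^ n) := by
  simpa using prod (Finset.range n) (d := fun _ => d) (g := fun _ => g) fun _ _ => hg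

theorem linear (i : ι) (L : (Fin (m + 1) → ℂ) →ₗ[ℂ] ℂ) :
    IsForm (Pi.single i 1) (fun v : ι → Fin (m + 1) → ℂ => L (v i)) := by
  have hX : ∀ k : Fin (m + 1), IsForm (Pi.single i 1) (fun v : ι → Fin (m + 1) → ℂ => v i k) :=
    fun k => ⟨X (i, k), (isMultihomogeneous_iff _ _).2
      (isWeightedHomogeneous_X ℂ (multiweight m) (i, k)), fun v => by simp⟩
  have := sum Finset.univ fun k _ => (hX k).const_mul (L (Pi.single k 1))
  convert this using 2 with v
  rw [LinearMap.pi_apply_eq_sum_univ L (v i)]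
  refine Finset.sum_congr rfl fun k _ => ?_
  rw [smul_eq_mul, mul_comm]
  congr 2
  ext j
  simp [Pi.single_apply, eq_comm]

theorem det {k : ℕ} (s : Fin k → ι) (L : Fin k → (Fin (m + 1) → ℂ) →ₗ[ℂ] ℂ) :
    IsForm (∑ l, Pi.single (s l) 1)
      (fun v : ι → Fin (m + 1) → ℂ => (Matrix.of fun r l => L r (v (s l))).det) := by
  simp only [Matrix.det_apply']
  refine sum _ fun σ _ => const_mul _ ?_
  exact prod Finset.univ fun l _ => linear (s l) (L (σ l))

/-- Substituting forms of the same multidegree for the coordinates of each vector. -/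
theorem comp {κ : Type} [Fintype κ] {l : ℕ} {d : κ → ℕ}
    {g : (κ → Fin (l + 1) → ℂ) → ℂ} (hg : IsForm d g) (e : κ → ι → ℕ)
    (f : κ → (ι → Fin (m + 1) → ℂ) → (Fin (l + 1) → ℂ))
    (hf : ∀ q k, IsForm (e q) (fun v => f q v k)) :
    IsForm (∑ q, d q • e q) (fun v => g (fun q => f q v)) := by
  obtain ⟨F, hF, hFv⟩ := hg
  have : (fun v => g (fun q => f q v)) = fun v => ∑ s ∈ F.support, coeff s F *
      ∏ q, ∏ k, f q v k ^ s (q, k) := by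
    funext v
    rw [← hFv, eval_eq']
    simp only [Fintype.prod_prod_type]
  rw [this]
  refine sum _ fun s hs => const_mul _ (prod _ fun q _ => ?_)
  rw [← hF s hs q, Finset.sum_smul]
  exact prod _ fun k _ => (hf q k).pow _

omit [DecidableEq ι] in
theorem smul (hg : IsForm d g) (c : ι → ℂ) (v : ι → Fin (m + 1) → ℂ) :
    g (fun i => c i • v i) = (∏ i, c i ^ d i) * g v := by
  obtain ⟨F, hF, hFv⟩ := hg
  rw [← hFv, ← hFv, eval_eq', eval_eq', Finset.mul_sum]
  refine Finset.sum_congr rfl fun s hs => ?_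
  rw [mul_left_comm]
  congr 1
  simp only [Pi.smul_apply, smul_eq_mul, mul_pow, Finset.prod_mul_distrib]
  congr 1
  rw [Fintype.prod_prod_type]
  refine Finset.prod_congr rfl fun i _ => ?_
  rw [← hF s hs i]
  exact Finset.prod_pow_eq_pow_sum Finset.univ (fun k => s (i, k)) (c i)

omit [DecidableEq ι] in
/-- Whether a form vanishes at a point does not depend on the representatives. -/
theorem rep_ne_zero_iff (hg : IsForm d g) (v : ι → Fin (m + 1) → ℂ) (hv : ∀ i, v i ≠ 0) :
    g (fun i => (Projectivization.mk ℂ (v i) (hv i)).rep) ≠ 0 ↔ g v ≠ 0 := by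
  choose a ha using fun i => Projectivization.exists_smul_eq_mk_rep ℂ (v i) (hv i)
  have : (fun i => (Projectivization.mk ℂ (v i) (hv i)).rep) = fun i => (a i : ℂ) • v i :=
    funext fun i => (ha i).symm
  rw [this, hg.smul, mul_ne_zero_iff, and_iff_right]
  exact Finset.prod_ne_zero_iff.2 fun i _ => pow_ne_zero _ (a i).ne_zero

omit [Fintype ι] [DecidableEq ι] in
theorem isOpen (hg : IsForm d g) :
    IsOpen {p : MultiProj ι m | g (fun i => (p i).rep) ≠ 0} := by
  obtain ⟨F, hF, hFv⟩ := hg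
  refine TopologicalSpace.isOpen_generateFrom_of_mem ⟨F, d, hF, ?_⟩
  simp only [nonvanishing, ← hFv]

end IsForm

section

variable {ι : Type} {m : ℕ}

/-- The vector form of the basis of open sets. -/
theorem zariski_eq : zariski ι m = TopologicalSpace.generateFrom
    {U | ∃ d g, IsForm d g ∧ U = {p : MultiProj ι m | g (fun i => (p i).rep) ≠ 0}} := by
  unfold zariski
  congr 1
  ext U
  constructor
  · rintro ⟨F, d, hF, hU⟩
    refine ⟨d, _, ⟨F, hF, fun v => Eq.refl _⟩, ?_⟩
    rw [hU, nonvanishing]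
  · rintro ⟨d, g, ⟨F, hF, hFv⟩, rfl⟩
    refine ⟨F, d, hF, ?_⟩
    simp only [nonvanishing, ← hFv]

theorem isTopologicalBasis [Fintype ι] [DecidableEq ι] : TopologicalSpace.IsTopologicalBasis
    {U | ∃ d g, IsForm d g ∧ U = {p : MultiProj ι m | g (fun i => (p i).rep) ≠ 0}} where
  exists_subset_inter := by
    rintro _ ⟨d, g, hg, rfl⟩ _ ⟨e, h, hh, rfl⟩ p ⟨hp1, hp2⟩
    refine ⟨_, ⟨_, _, hg.mul hh, rfl⟩, mul_ne_zero hp1 hp2, fun q hq => ?_⟩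
    exact ⟨left_ne_zero_of_mul hq, right_ne_zero_of_mul hq⟩
  sUnion_eq := Set.sUnion_eq_univ_iff.2 fun p =>
    ⟨_, ⟨_, _, IsForm.const 1, rfl⟩, one_ne_zero⟩
  eq_generateFrom := zariski_eq

theorem continuous_of_isForm {X : Type*} [TopologicalSpace X] (f : X → MultiProj ι m)
    (h : ∀ d g, IsForm d g → IsOpen {x | g (fun i => (f x i).rep) ≠ 0}) : Continuous f := by
  rw [zariski_eq, continuous_generateFrom_iff]
  rintro _ ⟨d, g, hg, rfl⟩
  exact h d g hg

/-- A product of projective spaces is irreducible. -/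
instance preirreducibleSpace [Fintype ι] [DecidableEq ι] : PreirreducibleSpace (MultiProj ι m) where
  isPreirreducible_univ := by
    rintro u v hu hv ⟨x, -, hx⟩ ⟨y, -, hy⟩
    obtain ⟨_, ⟨d, g, ⟨F, hF, hFv⟩, rfl⟩, hxg, hgu⟩ :=
      isTopologicalBasis.exists_subset_of_mem_open hx hu
    obtain ⟨_, ⟨e, h, ⟨G, hG, hGv⟩, rfl⟩, hyh, hhv⟩ :=
      isTopologicalBasis.exists_subset_of_mem_open hy hv
    have hF0 : F ≠ 0 := by
      rintro rfl
      exact hxg (by simp [← hFv])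
    have hG0 : G ≠ 0 := by
      rintro rfl
      exact hyh (by simp [← hGv])
    -- This extra factor makes every vector of the point found below nonzero, so that it defines a
    -- point of the product.
    have hX0 : (∏ i : ι, (X (i, 0) : MvPolynomial (ι × Fin (m + 1)) ℂ)) ≠ 0 :=
      Finset.prod_ne_zero_iff.2 fun i _ => X_ne_zero _
    have hne := mul_ne_zero (mul_ne_zero hF0 hG0) hX0
    obtain ⟨z, hz⟩ : ∃ z, eval z (F * G * ∏ i : ι, X (i, 0)) ≠ 0 := by
      by_contra! hcon
      exact hne (MvPolynomial.funext fun z => by rw [hcon z, map_zero])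
    simp only [map_mul, map_prod, eval_X] at hz
    let w : ι → Fin (m + 1) → ℂ := fun i k => z (i, k)
    have hw : ∀ i, w i ≠ 0 := fun i hi =>
      Finset.prod_ne_zero_iff.1 (right_ne_zero_of_mul hz) i (Finset.mem_univ i) (congrFun hi 0)
    refine ⟨fun i => Projectivization.mk ℂ (w i) (hw i), trivial, hgu ?_, hhv ?_⟩
    · refine (IsForm.rep_ne_zero_iff ⟨F, hF, hFv⟩ w hw).2 ?_
      rw [← hFv]
      exact left_ne_zero_of_mul (left_ne_zero_of_mul hz)
    · refine (IsForm.rep_ne_zero_iff ⟨G, hG, hGv⟩ w hw).2 ?_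
      rw [← hGv]
      exact right_ne_zero_of_mul (left_ne_zero_of_mul hz)

/-- The determinants on the right are forms in the vectors, so this presents independence as a union
of basic open conditions. For independent vectors, a left inverse of the linear combination map
provides an identity matrix. -/
theorem exists_det_ne_zero_iff {k : ℕ} (v : Fin k → Fin (m + 1) → ℂ) :
    LinearIndependent ℂ v ↔ ∃ L : Fin k → (Fin (m + 1) → ℂ) →ₗ[ℂ] ℂ,
      (Matrix.of fun r l => L r (v l)).det ≠ 0 := by
  constructor
  · intro hv
    obtain ⟨T, hT⟩ := LinearMap.exists_leftInverse_of_injective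
      (Fintype.linearCombination ℂ v) (LinearMap.ker_eq_bot.2 hv.fintypeLinearCombination_injective)
    refine ⟨fun r => LinearMap.proj r ∘ₗ T, ?_⟩
    have : (Matrix.of fun r l => (LinearMap.proj r ∘ₗ T) (v l)) = (1 : Matrix (Fin k) (Fin k) ℂ) := by
      ext r l
      have := congrFun (LinearMap.congr_fun hT (Pi.single l 1)) r
      simp [Fintype.linearCombination_apply_single] at this
      simpa [Matrix.one_apply, Pi.single_apply] using this
    rw [this, Matrix.det_one]
    exact one_ne_zero
  · rintro ⟨L, hL⟩
    refine LinearIndependent.of_comp (LinearMap.pi L) ?_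
    have := Matrix.linearIndependent_cols_of_det_ne_zero hL
    exact this

/-- Linear independence is an open condition. -/
theorem isOpen_independent [Fintype ι] [DecidableEq ι] {k : ℕ} (s : Fin k → ι) :
    IsOpen {p : MultiProj ι m | Projectivization.Independent fun l => p (s l)} := by
  have : {p : MultiProj ι m | Projectivization.Independent fun l => p (s l)} =
      ⋃ L : Fin k → (Fin (m + 1) → ℂ) →ₗ[ℂ] ℂ,
        {p | (Matrix.of fun r l => L r ((p (s l)).rep)).det ≠ 0} := by
    ext p
    simp only [Set.mem_ofPred_eq, Projectivization.independent_iff, exists_det_ne_zero_iff,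
      Set.mem_iUnion, Function.comp_apply]
  rw [this]
  exact isOpen_iUnion fun L => (IsForm.det s L).isOpen

end

end Lift

/-! ### Krull dimension of a principal open subset of affine space. -/

namespace Lift

open MvPolynomial

theorem pointToPoint_mem_basicOpen {σ : Type*} (y : σ → ℂ) (f : MvPolynomial σ ℂ) :
    pointToPoint (k := ℂ) y ∈ PrimeSpectrum.basicOpen f ↔ eval y f ≠ 0 := by
  rw [PrimeSpectrum.mem_basicOpen, not_iff_not]
  simp [pointToPoint, mem_vanishingIdeal_iff, aeval_eq_eval]

section

variable {N : ℕ} {Z : Type*} [TopologicalSpace Z] {τ : Z → Fin (N + 1) → ℂ}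

theorem exists_basicOpen_of_isInducing
    (hτ : Topology.IsInducing fun z => pointToPoint (k := ℂ) (τ z)) {u : Set Z} (hu : IsOpen u)
    {z : Z} (hz : z ∈ u) : ∃ f : MvPolynomial (Fin (N + 1)) ℂ, eval (τ z) f ≠ 0 ∧
      ∀ z', eval (τ z') f ≠ 0 → z' ∈ u := by
  obtain ⟨O, hO, rfl⟩ := hτ.isOpen_iff.1 hu
  obtain ⟨_, ⟨f, rfl⟩, hf, hfO⟩ :=
    PrimeSpectrum.isTopologicalBasis_basic_opens.exists_subset_of_mem_open hz hO
  exact ⟨f, (pointToPoint_mem_basicOpen _ _).1 hf,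
    fun z' hz' => hfO ((pointToPoint_mem_basicOpen _ _).2 hz')⟩

theorem isOpen_eval_ne_zero_of_isInducing
    (hτ : Topology.IsInducing fun z => pointToPoint (k := ℂ) (τ z))
    (f : MvPolynomial (Fin (N + 1)) ℂ) : IsOpen {z | eval (τ z) f ≠ 0} := by
  convert (PrimeSpectrum.basicOpen f).2.preimage hτ.continuous using 1
  ext z
  exact (pointToPoint_mem_basicOpen _ _).symm

/-- The points whose coordinates from the `k`-th on are equal to `1`. -/
theorem isClosed_slice (hτ : Topology.IsInducing fun z => pointToPoint (k := ℂ) (τ z)) (k : ℕ) :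
    IsClosed {z | ∀ j : Fin (N + 1), k ≤ j → τ z j = 1} := by
  simp only [Set.ofPred_forall]
  refine isClosed_iInter fun j => isClosed_iInter fun _ => ⟨?_⟩
  convert isOpen_eval_ne_zero_of_isInducing hτ (X j - 1) using 1
  ext z
  simp [sub_eq_zero]

/-- A slice is parametrised by its free coordinates. Substituting `1` for the others keeps a
polynomial nonzero if it is nonzero somewhere on the slice, and a product of nonzero polynomials
over `ℂ` has a point where it does not vanish. -/
theorem isIrreducible_slice (hτ : Topology.IsInducing fun z => pointToPoint (k := ℂ) (τ z))
    (hr : ∀ y, (∃ z, τ z = y) ↔ y 0 ≠ 0) (k : ℕ) :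
    IsIrreducible {z | ∀ j : Fin (N + 1), k ≤ j → τ z j = 1} := by
  refine ⟨?_, ?_⟩
  · obtain ⟨z, hz⟩ := (hr 1).2 one_ne_zero
    exact ⟨z, fun j _ => by rw [hz, Pi.one_apply]⟩
  rintro u v hu hv ⟨x, hxS, hx⟩ ⟨y, hyS, hy⟩
  obtain ⟨f, hfx, hfu⟩ := exists_basicOpen_of_isInducing hτ hu hx
  obtain ⟨g, hgy, hgv⟩ := exists_basicOpen_of_isInducing hτ hv hy
  let s : Fin (N + 1) → MvPolynomial (Fin (N + 1)) ℂ := fun j => if k ≤ j then 1 else X j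
  let r : (Fin (N + 1) → ℂ) → (Fin (N + 1) → ℂ) := fun a j => if k ≤ j then 1 else a j
  have hs : ∀ a h, eval a (aeval s h) = eval (r a) h := by
    intro a h
    rw [← aeval_eq_eval, ← aeval_eq_eval, ← AlgHom.comp_apply, comp_aeval]
    congr 2
    funext j
    by_cases h : k ≤ j <;> simp [s, r, h]
  have hrx : ∀ z : Z, (∀ j : Fin (N + 1), k ≤ j → τ z j = 1) → r (τ z) = τ z := by
    intro z hz
    funext j
    simp only [r]
    split_ifs with h
    · exact (hz j h).symm
    · rfl
  have hne : ∀ (h : MvPolynomial (Fin (N + 1)) ℂ) (z : Z),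
      (∀ j : Fin (N + 1), k ≤ j → τ z j = 1) → eval (τ z) h ≠ 0 → aeval s h ≠ 0 := by
    intro h z hz hhz h0
    apply hhz
    rw [← hrx z hz, ← hs, h0, map_zero]
  -- The factor `X 0` ensures that the point found lies in the image of `τ`.
  have h0 := mul_ne_zero (mul_ne_zero (hne f x hxS hfx) (hne g y hyS hgy))
    (hne (X 0) x hxS (by rw [eval_X]; exact (hr _).1 ⟨x, rfl⟩))
  obtain ⟨a, ha⟩ : ∃ a, eval a (aeval s f * aeval s g * aeval s (X 0)) ≠ 0 := by
    by_contra! hcon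
    exact h0 (MvPolynomial.funext fun a => by rw [hcon a, map_zero])
  simp only [map_mul, hs, eval_X] at ha
  obtain ⟨z, hz⟩ := (hr (r a)).2 (right_ne_zero_of_mul ha)
  refine ⟨z, fun j hj => ?_, hfu z ?_, hgv z ?_⟩
  · rw [hz]
    exact if_pos hj
  · rw [hz]
    exact left_ne_zero_of_mul (left_ne_zero_of_mul ha)
  · rw [hz]
    exact right_ne_zero_of_mul (left_ne_zero_of_mul ha)

/-- The principal open subset of affine space where the first coordinate does not vanish has the
dimension of the affine space. -/
theorem topologicalKrullDim_of_isInducing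
    (hτ : Topology.IsInducing fun z => pointToPoint (k := ℂ) (τ z))
    (hr : ∀ y, (∃ z, τ z = y) ↔ y 0 ≠ 0) :
    topologicalKrullDim Z = ((N + 1 : ℕ) : WithBot ℕ∞) := by
  apply le_antisymm
  -- Upper bound: a space with topology induced from the spectrum has at most its dimension.
  · refine hτ.topologicalKrullDim_le.trans ?_
    rw [PrimeSpectrum.topologicalKrullDim_eq_ringKrullDim,
      MvPolynomial.ringKrullDim_of_isNoetherianRing, ringKrullDim_eq_zero_of_field, zero_add,
      Nat.card_fin]
  · rw [topologicalKrullDim]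
    -- Lower bound: the slices form a chain of `N + 2` irreducible closed sets, from the single
    -- value `(1, …, 1)` to the whole space.
    let S : Fin (N + 1 + 1) → TopologicalSpace.IrreducibleCloseds Z := fun k =>
      ⟨{z | ∀ j : Fin (N + 1), (k : ℕ) ≤ j → τ z j = 1}, isIrreducible_slice hτ hr k,
        isClosed_slice hτ k⟩
    have hS : StrictMono S := by
      rw [Fin.strictMono_iff_lt_succ]
      intro i
      refine lt_of_le_of_ne (fun z hz j hj => hz j ?_) fun h => ?_
      · simp only [Fin.val_succ, Fin.val_castSucc] at hj ⊢
        omega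
      -- The value `2` at `i` separates consecutive slices, and being nonzero it is allowed even for
      -- `i = 0`.
      · obtain ⟨z, hz⟩ := (hr (fun j => if j = i then 2 else 1)).2 (by split_ifs <;> norm_num)
        have h1 : z ∈ (S i.succ : Set Z) := by
          intro j hj
          rw [hz]
          refine if_neg ?_
          rintro rfl
          simp at hj
        rw [← h] at h1
        have := h1 i (by simp)
        norm_num [hz] at this
    exact Order.LTSeries.length_le_krullDim (LTSeries.mk (N + 1) S hS)

end

end Lift

/-! ### Linear algebra of points and their spans. -/

namespace Lift

section Join

variable {V : Type} [AddCommGroup V] [Module ℂ V]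

theorem eq_mk_of_mem {p : ℙ ℂ V} {u : V} (hu : u ∈ p.submodule) (hu0 : u ≠ 0) :
    p = Projectivization.mk ℂ u hu0 := by
  rw [Projectivization.submodule_eq, Submodule.mem_span_singleton] at hu
  obtain ⟨a, ha⟩ := hu
  conv_lhs => rw [← p.mk_rep]
  exact ((Projectivization.mk_eq_mk_iff' ℂ _ _ _ _).2 ⟨a, ha⟩).symm

theorem mem_submodule_mk {u : V} (hu0 : u ≠ 0) : u ∈ (Projectivization.mk ℂ u hu0).submodule := by
  rw [Projectivization.submodule_mk]
  exact Submodule.mem_span_singleton_self u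

theorem eq_of_mem_of_mem {p q : ℙ ℂ V} {u : V} (hp : u ∈ p.submodule) (hq : u ∈ q.submodule)
    (hu0 : u ≠ 0) : p = q :=
  (eq_mk_of_mem hp hu0).trans (eq_mk_of_mem hq hu0).symm

theorem exists_smul_eq {p : ℙ ℂ V} {u v : V} (hu : u ∈ p.submodule) (hu0 : u ≠ 0)
    (hv : v ∈ p.submodule) : ∃ a : ℂ, v = a • u := by
  rw [eq_mk_of_mem hu hu0, Projectivization.submodule_mk, Submodule.mem_span_singleton] at hv
  obtain ⟨a, ha⟩ := hv
  exact ⟨a, ha.symm⟩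

theorem mem_join_iff {p q : ℙ ℂ V} {u v z : V} (hu : u ∈ p.submodule) (hu0 : u ≠ 0)
    (hv : v ∈ q.submodule) (hv0 : v ≠ 0) :
    z ∈ join p q ↔ ∃ a b : ℂ, a • u + b • v = z := by
  rw [eq_mk_of_mem hu hu0, eq_mk_of_mem hv hv0, join, Projectivization.submodule_mk,
    Projectivization.submodule_mk, ← Submodule.span_insert, Submodule.mem_span_pair]

theorem submodule_le_iff {p : ℙ ℂ V} {u : V} (hu : u ∈ p.submodule) (hu0 : u ≠ 0)
    (S : Submodule ℂ V) : p.submodule ≤ S ↔ u ∈ S := by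
  refine ⟨fun h => h hu, fun h => ?_⟩
  rw [eq_mk_of_mem hu hu0, Projectivization.submodule_mk]
  exact (Submodule.span_singleton_le_iff_mem _ _).2 h

theorem rep_mem (p : ℙ ℂ V) : p.rep ∈ p.submodule := by
  rw [Projectivization.submodule_eq]
  exact Submodule.mem_span_singleton_self _

/-- Used to turn `x_bd ∈ ⟨x_ab, x_ad⟩` into `x_ad ∈ ⟨x_ab, x_bd⟩`, which locates `x_ad` on a line
already known. -/
theorem join_exchange {p q r : ℙ ℂ V} (h : r.submodule ≤ join p q) (hne : r ≠ p) :
    q.submodule ≤ join p r := by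
  obtain ⟨a, b, hab⟩ := (mem_join_iff (rep_mem p) p.rep_nonzero (rep_mem q) q.rep_nonzero).1
    (h (rep_mem r))
  have hb : b ≠ 0 := by
    rintro rfl
    refine hne (eq_of_mem_of_mem (rep_mem r) ?_ r.rep_nonzero)
    rw [← hab, zero_smul, add_zero]
    exact Submodule.smul_mem _ _ (rep_mem p)
  rw [submodule_le_iff (rep_mem q) q.rep_nonzero,
    mem_join_iff (rep_mem p) p.rep_nonzero (rep_mem r) r.rep_nonzero]
  refine ⟨-(b⁻¹ * a), b⁻¹, ?_⟩
  rw [← hab, smul_add, smul_smul, smul_smul, inv_mul_cancel₀ hb, one_smul]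
  module

theorem independent_iff_of_mem {k : ℕ} {p : Fin k → ℙ ℂ V} {u : Fin k → V}
    (hu : ∀ i, u i ∈ (p i).submodule) (hu0 : ∀ i, u i ≠ 0) :
    Projectivization.Independent p ↔ LinearIndependent ℂ u := by
  choose a ha using fun i => exists_smul_eq (hu i) (hu0 i) (rep_mem (p i))
  have ha0 : ∀ i, a i ≠ 0 := fun i h => (p i).rep_nonzero (by rw [ha i, h, zero_smul])
  have : Projectivization.rep ∘ p = (fun i => Units.mk0 (a i) (ha0 i)) • u :=
    funext fun i => ha i
  rw [Projectivization.independent_iff, this, LinearIndependent.units_smul_iff]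

theorem independent_triple_iff {p q r : ℙ ℂ V} (hpq : p ≠ q) :
    Projectivization.Independent ![r, p, q] ↔ ¬ r.submodule ≤ join p q := by
  have hli : LinearIndependent ℂ ![p.rep, q.rep] := by
    have h2 : ![p.rep, q.rep] = Projectivization.rep ∘ ![p, q] := by
      ext i
      fin_cases i <;> rfl
    rw [h2, ← Projectivization.independent_iff, Projectivization.independent_pair_iff_ne]
    exact hpq
  have h3 : Projectivization.rep ∘ ![r, p, q] =
      (Fin.cons r.rep ![p.rep, q.rep] : Fin 3 → V) := by
    ext i
    fin_cases i <;> rfl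
  rw [Projectivization.independent_iff, h3, linearIndependent_finCons, and_iff_right hli,
    submodule_le_iff (rep_mem r) r.rep_nonzero, Matrix.range_cons, Matrix.range_cons,
    Matrix.range_empty, Set.union_empty, Set.singleton_union, Submodule.mem_span_pair,
    mem_join_iff (rep_mem p) p.rep_nonzero (rep_mem q) q.rep_nonzero]

theorem LinearIndependent.eq_zero_of_triple {u v w : V} (h : LinearIndependent ℂ ![u, v, w])
    {a b c : ℂ} (habc : a • u + b • v + c • w = 0) : a = 0 ∧ b = 0 ∧ c = 0 := by
  have := Fintype.linearIndependent_iff.1 h ![a, b, c] (by simpa [Fin.sum_univ_three] using habc)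
  exact ⟨this 0, this 1, this 2⟩

end Join

end Lift

/-! ### Generic configurations and their lifts to vectors. -/

namespace Lift

variable {n t : ℕ}

/-- The open conditions of nondegeneracy: the points `x_ab, x_ac, x_bc` are pairwise distinct, and
`x_bd` is not on the line `l_abc`. -/
def generic (n t : ℕ) : Set (MultiProj (Pairs t) n) :=
  {x | (∀ (a b c : Fin t) (hab : a < b) (hbc : b < c),
      x (pr hab) ≠ x (pr (hab.trans hbc)) ∧ x (pr hab) ≠ x (pr hbc) ∧
        x (pr (hab.trans hbc)) ≠ x (pr hbc)) ∧
    ∀ (a b c d : Fin t) (hab : a < b) (hbc : b < c) (hcd : c < d),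
      Projectivization.Independent
        ![x (pr (hbc.trans hcd)), x (pr hab), x (pr (hab.trans hbc))]}

theorem isOpen_ne {ι : Type} [Fintype ι] [DecidableEq ι] {m : ℕ} (i j : ι) :
    IsOpen {p : MultiProj ι m | p i ≠ p j} := by
  convert isOpen_independent (m := m) ![i, j] using 1
  ext p
  rw [Set.mem_ofPred_eq, Set.mem_ofPred_eq, ← Projectivization.independent_pair_iff_ne]
  have : (fun l => p (![i, j] l)) = ![p i, p j] := by
    ext l
    fin_cases l <;> rfl
  rw [this]

theorem isOpen_independent_triple {ι : Type} [Fintype ι] [DecidableEq ι] {m : ℕ} (i j k : ι) :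
    IsOpen {p : MultiProj ι m | Projectivization.Independent ![p i, p j, p k]} := by
  convert isOpen_independent (m := m) ![i, j, k] using 1
  ext p
  have : (fun l => p (![i, j, k] l)) = ![p i, p j, p k] := by
    ext l
    fin_cases l <;> rfl
  rw [Set.mem_ofPred_eq, Set.mem_ofPred_eq, this]

theorem isOpen_generic : IsOpen (generic n t) := by
  have : generic n t = (⋂ (a : Fin t) (b : Fin t) (c : Fin t) (hab : a < b) (hbc : b < c),
      {x | x (pr hab) ≠ x (pr (hab.trans hbc))} ∩ ({x | x (pr hab) ≠ x (pr hbc)} ∩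
        {x | x (pr (hab.trans hbc)) ≠ x (pr hbc)})) ∩
      ⋂ (a : Fin t) (b : Fin t) (c : Fin t) (d : Fin t) (hab : a < b) (hbc : b < c) (hcd : c < d),
        {x | Projectivization.Independent
          ![x (pr (hbc.trans hcd)), x (pr hab), x (pr (hab.trans hbc))]} := by
    ext x
    simp [generic]
  rw [this]
  exact (isOpen_iInter_of_finite fun a => isOpen_iInter_of_finite fun b =>
    isOpen_iInter_of_finite fun c => isOpen_iInter_of_finite fun hab =>
    isOpen_iInter_of_finite fun hbc =>
      (isOpen_ne _ _).inter ((isOpen_ne _ _).inter (isOpen_ne _ _))).inter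
    (isOpen_iInter_of_finite fun a => isOpen_iInter_of_finite fun b =>
    isOpen_iInter_of_finite fun c => isOpen_iInter_of_finite fun d =>
    isOpen_iInter_of_finite fun hab => isOpen_iInter_of_finite fun hbc =>
    isOpen_iInter_of_finite fun hcd => isOpen_independent_triple _ _ _)

/-- In a configuration `x_bc` already lies on `l_abc`. So if `x_bd` does too, then `l_bcd` is
contained in `l_abc` and equals it by dimension. -/
theorem configurations_inter_nondegenerate :
    configurations n t ∩ nondegenerate n t = configurations n t ∩ generic n t := by
  ext x
  refine and_congr_right fun hx => and_congr_right fun hne => ?_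
  refine forall_congr' fun a => forall_congr' fun b => forall_congr' fun c => forall_congr' fun d =>
    forall_congr' fun hab => forall_congr' fun hbc => forall_congr' fun hcd => ?_
  rw [independent_triple_iff (hne a b c hab hbc).1, not_iff_not]
  constructor
  · intro h
    rw [h]
    exact le_sup_right
  · intro h
    have hle : join (x (pr hbc)) (x (pr (hbc.trans hcd))) ≤
        join (x (pr hab)) (x (pr (hab.trans hbc))) := sup_le (hx a b c hab hbc) h
    refine (Submodule.eq_of_le_of_finrank_le hle ?_).symm
    refine (Submodule.finrank_add_le_finrank_add_finrank _ _).trans ?_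
    rw [Projectivization.finrank_submodule, Projectivization.finrank_submodule]
    have hne' := (hne b c d hbc hcd).1
    rw [← Projectivization.independent_pair_iff_ne, Projectivization.independent_iff] at hne'
    have hc := finrank_span_eq_card hne'
    rw [Fintype.card_fin] at hc
    refine hc.ge.trans (Submodule.finrank_mono (Submodule.span_le.2 ?_))
    rintro _ ⟨i, rfl⟩
    fin_cases i
    · exact Submodule.mem_sup_left (rep_mem _)
    · exact Submodule.mem_sup_right (rep_mem _)

/-- Where `x_ab ≠ x_ac`, failure of an incidence is independence of three points, an open condition.
A point of the closure where it held would have a nearby configuration violating the incidence. -/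
theorem generic_inter_W_subset : generic n t ∩ W n t ⊆ configurations n t := by
  rintro x ⟨hx, hxW⟩ a b c hab hbc
  by_contra hcon
  rw [← independent_triple_iff (hx.1 a b c hab hbc).1] at hcon
  rw [W, configurations_inter_nondegenerate] at hxW
  obtain ⟨y, hy, hyc, hyg⟩ := mem_closure_iff.1 hxW _ (isOpen_independent_triple _ _ _) hcon
  exact (independent_triple_iff (hyg.1 a b c hab hbc).1).1 hy (hyc a b c hab hbc)

/-- Vectors whose differences represent the points of a configuration. -/
def IsLift (x : MultiProj (Pairs t) n) (w : Fin t → Fin (n + 1) → ℂ) : Prop :=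
  ∀ (i j : Fin t) (h : i < j), w j - w i ∈ (x (pr h)).submodule ∧ w j - w i ≠ 0

theorem IsLift.mem_configurations {x : MultiProj (Pairs t) n} {w : Fin t → Fin (n + 1) → ℂ}
    (h : IsLift x w) : x ∈ configurations n t := by
  intro a b c hab hbc
  rw [submodule_le_iff (h b c hbc).1 (h b c hbc).2, mem_join_iff (h a b hab).1 (h a b hab).2
    (h a c (hab.trans hbc)).1 (h a c (hab.trans hbc)).2]
  exact ⟨-1, 1, by module⟩

/-- If `x_ad` is on the lines through the points `e₁, e₃` and `e₂, e₁ + e₃ - e₂`, it is the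
intersection point `e₁ + e₃`. -/
theorem sum_mem_of_mem_join {V : Type} [AddCommGroup V] [Module ℂ V] {p₁ p₂ p₃ p₄ q : ℙ ℂ V}
    {e₁ e₂ e₃ : V} (h₁ : e₁ ∈ p₁.submodule) (h₂ : e₂ ∈ p₂.submodule) (h₃ : e₃ ∈ p₃.submodule)
    (h₄ : e₁ + e₃ - e₂ ∈ p₄.submodule) (h₁₀ : e₁ ≠ 0) (h₂₀ : e₂ ≠ 0) (h₃₀ : e₃ ≠ 0)
    (h₄₀ : e₁ + e₃ - e₂ ≠ 0) (hli : LinearIndependent ℂ ![e₃, e₁, e₂])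
    (hq₁ : q.submodule ≤ join p₁ p₃) (hq₂ : q.submodule ≤ join p₂ p₄) :
    e₁ + e₃ ∈ q.submodule ∧ e₁ + e₃ ≠ 0 := by
  obtain ⟨a, b, hab⟩ := (mem_join_iff h₁ h₁₀ h₃ h₃₀).1 (hq₁ (rep_mem q))
  obtain ⟨c, d, hcd⟩ := (mem_join_iff h₂ h₂₀ h₄ h₄₀).1 (hq₂ (rep_mem q))
  have h0 : (b - d) • e₃ + (a - d) • e₁ + (d - c) • e₂ = 0 := by
    rw [← sub_eq_zero.2 (hab.trans hcd.symm)]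
    module
  obtain ⟨hbd, had, -⟩ := LinearIndependent.eq_zero_of_triple hli h0
  have hrep : q.rep = d • (e₁ + e₃) := by
    rw [← hab, sub_eq_zero.1 hbd, sub_eq_zero.1 had, smul_add]
  have hd : d ≠ 0 := fun h => q.rep_nonzero (by rw [hrep, h, zero_smul])
  refine ⟨?_, fun h => q.rep_nonzero (by rw [hrep, h, smul_zero])⟩
  have := Submodule.smul_mem _ d⁻¹ (rep_mem q)
  rwa [hrep, smul_smul, inv_mul_cancel₀ hd, one_smul] at this

/-- Induction on the number of vectors placed. The two preceding indices `b`, `c` determine the new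
vector `w d` by closing the triangle `b, c, d`. For `a < b`, the point `x_ad` lies on the lines
`⟨x_ab, x_bd⟩` and `⟨x_ac, x_cd⟩`, which are distinct by genericity and meet in the class of `w d -
w a`. -/
theorem exists_isLift {x : MultiProj (Pairs t) n} (hx : x ∈ configurations n t)
    (hg : x ∈ generic n t) : ∃ w, IsLift x w := by
  suffices ∀ k ≤ t, ∃ w : Fin t → Fin (n + 1) → ℂ, ∀ (i j : Fin t) (h : i < j), (j : ℕ) < k →
      w j - w i ∈ (x (pr h)).submodule ∧ w j - w i ≠ 0 by
    obtain ⟨w, hw⟩ := this t le_rfl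
    exact ⟨w, fun i j h => hw i j h j.2⟩
  intro k
  induction k with
  | zero => exact fun _ => ⟨0, fun i j h hj => absurd hj (Nat.not_lt_zero _)⟩
  | succ k ih =>
    intro hk
    obtain ⟨w, hw⟩ := ih (Nat.le_of_succ_le hk)
    let d : Fin t := ⟨k, hk⟩
    suffices ∃ z : Fin (n + 1) → ℂ, ∀ (i : Fin t) (h : i < d),
        z - w i ∈ (x (pr h)).submodule ∧ z - w i ≠ 0 by
      obtain ⟨z, hz⟩ := this
      refine ⟨Function.update w d z, fun i j h hj => ?_⟩
      have hid : i ≠ d := fun hid => by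
        have : (i : ℕ) = k := congrArg Fin.val hid
        have : (i : ℕ) < j := h
        omega
      rw [Function.update_of_ne hid]
      rcases eq_or_ne j d with rfl | hjd
      · rw [Function.update_self]
        exact hz i h
      · rw [Function.update_of_ne hjd]
        have : (j : ℕ) ≠ k := fun h => hjd (Fin.ext h)
        exact hw i j h (by omega)
    rcases k with _ | _ | k
    · exact ⟨0, fun i h => absurd h (Nat.not_lt_zero _)⟩
    · obtain ⟨o, ho⟩ : ∃ o : Fin t, (o : ℕ) = 0 := ⟨⟨0, by omega⟩, rfl⟩
      have hod : o < d := Fin.lt_def.2 (by rw [ho]; exact Nat.zero_lt_one)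
      refine ⟨w o + (x (pr hod)).rep, fun i h => ?_⟩
      obtain rfl : o = i := Fin.ext (ho.trans (Nat.lt_one_iff.1 h).symm)
      rw [add_sub_cancel_left]
      exact ⟨rep_mem _, Projectivization.rep_nonzero _⟩
    · let b : Fin t := ⟨k, by omega⟩
      let c : Fin t := ⟨k + 1, by omega⟩
      have hbc : b < c := Nat.lt_succ_self k
      have hcd : c < d := Nat.lt_succ_self (k + 1)
      obtain ⟨hu, hu0⟩ := hw b c hbc (Nat.lt_succ_self (k + 1))
      obtain ⟨hne1, hne2, hne3⟩ := hg.1 b c d hbc hcd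
      obtain ⟨α, β, hαβ⟩ := (mem_join_iff hu hu0 (rep_mem (x (pr (hbc.trans hcd))))
        (Projectivization.rep_nonzero _)).1 (hx b c d hbc hcd (rep_mem (x (pr hcd))))
      have hα : α ≠ 0 := by
        rintro rfl
        refine hne3 (eq_of_mem_of_mem ?_ (rep_mem _) (Projectivization.rep_nonzero _))
        rw [← hαβ, zero_smul, zero_add]
        exact Submodule.smul_mem _ _ (rep_mem _)
      have hβ : β ≠ 0 := by
        rintro rfl
        refine hne2 (eq_of_mem_of_mem ?_ (rep_mem _) (Projectivization.rep_nonzero _))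
        rw [← hαβ, zero_smul, add_zero]
        exact Submodule.smul_mem _ _ hu
      have hs : -(α⁻¹ * β) ≠ 0 := neg_ne_zero.2 (mul_ne_zero (inv_ne_zero hα) hβ)
      -- The unknown `w d - w b`. The factor is forced by requiring `e₃ - (w c - w b)` to be a
      -- multiple of the representative `α (w c - w b) + β rep` of `x_cd`.
      set e₃ : Fin (n + 1) → ℂ := (-(α⁻¹ * β)) • (x (pr (hbc.trans hcd))).rep with he₃
      have he₃m : e₃ ∈ (x (pr (hbc.trans hcd))).submodule := Submodule.smul_mem _ _ (rep_mem _)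
      have he₃0 : e₃ ≠ 0 := smul_ne_zero hs (Projectivization.rep_nonzero _)
      have hcde : w b + e₃ - w c = (-α⁻¹) • (x (pr hcd)).rep := by
        rw [← hαβ, he₃, smul_add, smul_smul, smul_smul, neg_mul, inv_mul_cancel₀ hα]
        module
      have hcdm : w b + e₃ - w c ∈ (x (pr hcd)).submodule := by
        rw [hcde]
        exact Submodule.smul_mem _ _ (rep_mem _)
      have hcd0 : w b + e₃ - w c ≠ 0 := by
        rw [hcde]
        exact smul_ne_zero (neg_ne_zero.2 (inv_ne_zero hα)) (Projectivization.rep_nonzero _)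
      refine ⟨w b + e₃, fun a had => ?_⟩
      rcases eq_or_ne a c with rfl | hac
      · exact ⟨hcdm, hcd0⟩
      rcases eq_or_ne a b with rfl | hab
      · rw [add_sub_cancel_left]
        exact ⟨he₃m, he₃0⟩
      replace hab : a < b := by
        have h1 : (a : ℕ) ≠ k := fun h => hab (Fin.ext h)
        have h2 : (a : ℕ) ≠ k + 1 := fun h => hac (Fin.ext h)
        have h3 : (a : ℕ) < k + 1 + 1 := had
        exact Fin.lt_def.2 (by show (a : ℕ) < k; omega)
      obtain ⟨h1, h10⟩ := hw a b hab (by show k < k + 1 + 1; omega)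
      obtain ⟨h2, h20⟩ := hw a c (hab.trans hbc) (Nat.lt_succ_self (k + 1))
      have h4 : w b - w a + e₃ - (w c - w a) = w b + e₃ - w c := by module
      have h5 : w b + e₃ - w a = w b - w a + e₃ := by module
      rw [h5]
      -- Here `e₁ = w b - w a` and `e₂ = w c - w a`, so `e₁ + e₃` is the difference wanted for
      -- `x_ad`.
      refine sum_mem_of_mem_join h1 h2 he₃m (p₄ := x (pr hcd)) (h4 ▸ hcdm) h10 h20 he₃0 (h4 ▸ hcd0)
        ?_ ?_ ?_
      · refine (independent_iff_of_mem ?_ ?_).1 (hg.2 a b c d hab hbc hcd)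
        · intro i
          fin_cases i
          exacts [he₃m, h1, h2]
        · intro i
          fin_cases i
          exacts [he₃0, h10, h20]
      · exact join_exchange (hx a b d hab (hbc.trans hcd)) (hg.1 a b d hab (hbc.trans hcd)).2.1.symm
      · exact join_exchange (hx a c d (hab.trans hbc) hcd)
          (hg.1 a c d (hab.trans hbc) hcd).2.1.symm

/-- A lift is unique up to homotheties and translations. -/
theorem IsLift.exists_eq {x : MultiProj (Pairs t) n} {w w' : Fin t → Fin (n + 1) → ℂ}
    (hg : x ∈ generic n t) (hw : IsLift x w) (hw' : IsLift x w') (ht : 2 ≤ t) :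
    ∃ c : ℂ, c ≠ 0 ∧ ∀ i, w' i - w' ⟨0, by omega⟩ = c • (w i - w ⟨0, by omega⟩) := by
  let o : Fin t := ⟨0, by omega⟩
  let l : Fin t := ⟨1, by omega⟩
  have hol : o < l := Nat.zero_lt_one
  obtain ⟨c, hc⟩ := exists_smul_eq (hw o l hol).1 (hw o l hol).2 (hw' o l hol).1
  refine ⟨c, fun h => (hw' o l hol).2 (by rw [hc, h, zero_smul]), fun j => ?_⟩
  show w' j - w' o = c • (w j - w o)
  rcases eq_or_ne j o with rfl | hjo
  · simp
  rcases eq_or_ne j l with rfl | hjl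
  · exact hc
  have hlj : l < j := by
    have h0 : (j : ℕ) ≠ 0 := fun h => hjo (Fin.ext h)
    have h1 : (j : ℕ) ≠ 1 := fun h => hjl (Fin.ext h)
    exact Fin.lt_def.2 (by show 1 < (j : ℕ); omega)
  have hoj := hol.trans hlj
  obtain ⟨a, ha⟩ := exists_smul_eq (hw o j hoj).1 (hw o j hoj).2 (hw' o j hoj).1
  obtain ⟨b, hb⟩ := exists_smul_eq (hw l j hlj).1 (hw l j hlj).2 (hw' l j hlj).1
  have hli : LinearIndependent ℂ ![w l - w o, w j - w o] := by
    refine (independent_iff_of_mem ?_ ?_).1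
      ((Projectivization.independent_pair_iff_ne _ _).2 (hg.1 o l j hol hlj).1)
    · intro i
      fin_cases i
      exacts [(hw o l hol).1, (hw o j hoj).1]
    · intro i
      fin_cases i
      exacts [(hw o l hol).2, (hw o j hoj).2]
  -- The triangle `o, l, j` closes in both lifts. Independence of two of its sides makes the three
  -- scale factors equal.
  have h0 : (c - b) • (w l - w o) + (b - a) • (w j - w o) = 0 := by
    have : (w' l - w' o) + (w' j - w' l) - (w' j - w' o) = 0 := by module
    rw [hc, hb, ha] at this
    rw [← this]
    module
  obtain ⟨h1, h2⟩ := LinearIndependent.pair_iff.1 hli _ _ h0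
  rw [ha, ← sub_eq_zero.1 h2, ← sub_eq_zero.1 h1]

end Lift

/-! ### Affine coordinates off the hyperplane and the map in these coordinates. -/

namespace Lift

variable {n t : ℕ}

/-- A complement of the hyperplane `R`: a linear form `lam` with kernel `R`, a vector `e` outside
of `R`, and the projection `psi` onto `R` along `e`. -/
structure Splitting (φ : (Fin (n + 1) → ℂ) →ₗ[ℂ] (Fin (n + 1 + 1) → ℂ)) where
  lam : (Fin (n + 1 + 1) → ℂ) →ₗ[ℂ] ℂ
  psi : (Fin (n + 1 + 1) → ℂ) →ₗ[ℂ] (Fin (n + 1) → ℂ)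
  e : Fin (n + 1 + 1) → ℂ
  lam_map : ∀ u, lam (φ u) = 0
  psi_map : ∀ u, psi (φ u) = u
  lam_e : lam e = 1
  psi_e : psi e = 0
  map_add_smul : ∀ z, φ (psi z) + lam z • e = z

theorem nonempty_splitting (φ : (Fin (n + 1) → ℂ) →ₗ[ℂ] (Fin (n + 1 + 1) → ℂ))
    (hφ : Function.Injective φ) : Nonempty (Splitting φ) := by
  obtain ⟨psi, hpsi⟩ := LinearMap.exists_leftInverse_of_injective φ (LinearMap.ker_eq_bot.2 hφ)
  replace hpsi : ∀ u, psi (φ u) = u := fun u => LinearMap.congr_fun hpsi u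
  have hr : Module.finrank ℂ (LinearMap.range φ) = n + 1 := by
    rw [LinearMap.finrank_range_of_inj hφ]; simp
  have hlt : LinearMap.range φ < ⊤ := by
    refine lt_top_iff_ne_top.2 fun h => ?_
    rw [h, finrank_top] at hr
    simp at hr
  obtain ⟨lam, hlam0, hlam⟩ := Submodule.exists_le_ker_of_lt_top _ hlt
  have hker : LinearMap.ker lam = LinearMap.range φ := by
    refine (Submodule.eq_of_le_of_finrank_le hlam ?_).symm
    have h1 := LinearMap.finrank_range_add_finrank_ker lam
    rw [LinearMap.range_eq_top.2 (LinearMap.surjective hlam0)] at h1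
    simp at h1
    omega
  replace hlam : ∀ u, lam (φ u) = 0 := fun u => hlam ⟨u, rfl⟩
  obtain ⟨z, hz⟩ : ∃ z, lam z = 1 := LinearMap.surjective hlam0 1
  have he : lam (z - φ (psi z)) = 1 := by rw [map_sub, hlam, hz, sub_zero]
  have hpe : psi (z - φ (psi z)) = 0 := by rw [map_sub, hpsi, sub_self]
  refine ⟨⟨lam, psi, z - φ (psi z), hlam, hpsi, he, hpe, fun y => ?_⟩⟩
  have hmem : y - lam y • (z - φ (psi z)) ∈ LinearMap.range φ := by
    rw [← hker, LinearMap.mem_ker, map_sub, map_smul, he, smul_eq_mul, mul_one, sub_self]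
  obtain ⟨u, hu⟩ := hmem
  have hu' := congrArg psi hu
  rw [hpsi, map_sub, map_smul, hpe, smul_zero, sub_zero] at hu'
  rw [← hu', hu, sub_add_cancel]

variable {φ : (Fin (n + 1) → ℂ) →ₗ[ℂ] (Fin (n + 1 + 1) → ℂ)}

namespace Splitting

variable (S : Splitting φ)

theorem mem_range_iff (z : Fin (n + 1 + 1) → ℂ) : z ∈ LinearMap.range φ ↔ S.lam z = 0 := by
  constructor
  · rintro ⟨u, rfl⟩
    exact S.lam_map u
  · intro h
    refine ⟨S.psi z, ?_⟩
    conv_rhs => rw [← S.map_add_smul z, h, zero_smul, add_zero]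

theorem map_psi {z : Fin (n + 1 + 1) → ℂ} (h : S.lam z = 0) : φ (S.psi z) = z := by
  conv_rhs => rw [← S.map_add_smul z, h, zero_smul, add_zero]

theorem lam_ne_zero_iff_of_mem {P : ℙ ℂ (Fin (n + 1 + 1) → ℂ)} {v : Fin (n + 1 + 1) → ℂ}
    (hv : v ∈ P.submodule) (hv0 : v ≠ 0) : S.lam v ≠ 0 ↔ S.lam P.rep ≠ 0 := by
  obtain ⟨a, ha⟩ := exists_smul_eq hv hv0 (rep_mem P)
  have ha0 : a ≠ 0 := fun h => P.rep_nonzero (by rw [ha, h, zero_smul])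
  rw [ha, map_smul, smul_eq_mul, mul_ne_zero_iff, and_iff_right ha0]

theorem mem_domain_iff (p : MultiProj (Fin t) (n + 1)) : p ∈ domain t φ ↔
    ∀ i j : Fin t, i < j → p i ≠ p j ∧ (S.lam (p i).rep ≠ 0 ∨ S.lam (p j).rep ≠ 0) := by
  refine forall_congr' fun i => forall_congr' fun j => forall_congr' fun _ =>
    and_congr_right fun _ => ?_
  rw [join, sup_le_iff, submodule_le_iff (rep_mem _) (p i).rep_nonzero,
    submodule_le_iff (rep_mem _) (p j).rep_nonzero, S.mem_range_iff, S.mem_range_iff, not_and_or]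

include S in
theorem isOpen_domain : IsOpen (domain t φ) := by
  have : domain t φ = ⋂ (i : Fin t) (j : Fin t) (_ : i < j),
      {p : MultiProj (Fin t) (n + 1) | p i ≠ p j} ∩
        ({p | S.lam (p i).rep ≠ 0} ∪ {p | S.lam (p j).rep ≠ 0}) := by
    ext p
    rw [S.mem_domain_iff]
    simp
  rw [this]
  exact isOpen_iInter_of_finite fun i => isOpen_iInter_of_finite fun j =>
    isOpen_iInter_of_finite fun _ => (isOpen_ne _ _).inter
      ((IsForm.linear i S.lam).isOpen.union (IsForm.linear j S.lam).isOpen)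

/-- The vector of the intersection of `R` with the line through `v` and `w`. -/
noncomputable def sec (v w : Fin (n + 1 + 1) → ℂ) : Fin (n + 1) → ℂ :=
  S.psi (S.lam v • w - S.lam w • v)

theorem map_sec (v w : Fin (n + 1 + 1) → ℂ) : φ (S.sec v w) = S.lam v • w - S.lam w • v :=
  S.map_psi (by simp [mul_comm])

theorem sec_ne_zero {P Q : ℙ ℂ (Fin (n + 1 + 1) → ℂ)} (hPQ : P ≠ Q)
    (h : S.lam P.rep ≠ 0 ∨ S.lam Q.rep ≠ 0) : S.sec P.rep Q.rep ≠ 0 := by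
  intro h0
  have h1 := S.map_sec P.rep Q.rep
  rw [h0, map_zero, eq_comm, sub_eq_zero] at h1
  have key : ∀ {P Q : ℙ ℂ (Fin (n + 1 + 1) → ℂ)}, S.lam P.rep ≠ 0 →
      S.lam P.rep • Q.rep = S.lam Q.rep • P.rep → P = Q := by
    intro P Q hP hPQ
    refine eq_of_mem_of_mem (u := Q.rep) ?_ (rep_mem _) Q.rep_nonzero
    rw [← one_smul ℂ Q.rep, ← inv_mul_cancel₀ hP, mul_smul, hPQ]
    exact Submodule.smul_mem _ _ (Submodule.smul_mem _ _ (rep_mem _))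
  rcases h with h | h
  · exact hPQ (key h h1)
  · exact hPQ (key h h1.symm).symm

end Splitting

theorem map_projMap (hφ : Function.Injective φ) (p : domain t φ) (q : Pairs t) :
    (projMap φ hφ p q).submodule.map φ = join (p.1 q.1.1) (p.1 q.1.2) ⊓ LinearMap.range φ :=
  (existsUnique_section φ hφ (p.1 q.1.1) (p.1 q.1.2) (p.2 _ _ q.2).1
    (p.2 _ _ q.2).2).choose_spec.1

theorem mem_projMap_iff (hφ : Function.Injective φ) (p : domain t φ) (q : Pairs t)
    (u : Fin (n + 1) → ℂ) :
    u ∈ (projMap φ hφ p q).submodule ↔ φ u ∈ join (p.1 q.1.1) (p.1 q.1.2) := by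
  have : φ u ∈ (projMap φ hφ p q).submodule.map φ ↔ u ∈ (projMap φ hφ p q).submodule :=
    hφ.mem_set_image
  rw [← this, map_projMap, Submodule.mem_inf, and_iff_left (LinearMap.mem_range_self φ u)]

namespace Splitting

variable (S : Splitting φ)

theorem sec_mem_projMap (hφ : Function.Injective φ) (p : domain t φ) (q : Pairs t) :
    S.sec (p.1 q.1.1).rep (p.1 q.1.2).rep ∈ (projMap φ hφ p q).submodule := by
  rw [mem_projMap_iff, S.map_sec]
  exact Submodule.sub_mem _ (Submodule.smul_mem _ _ (Submodule.mem_sup_right (rep_mem _)))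
    (Submodule.smul_mem _ _ (Submodule.mem_sup_left (rep_mem _)))

-- The vector `sec` represents `x_ij` and is bilinear in the vectors of `p_i` and `p_j`, so forms
-- pull back to forms. It is nonzero on the domain, so non-vanishing can be tested on it.
include S in
theorem continuous_projMap (hφ : Function.Injective φ) :
    Continuous (projMap (t := t) φ hφ) := by
  refine continuous_of_isForm _ fun d g hg => ?_
  have hcomp := hg.comp (ι := Fin t) (m := n + 1)
    (fun q : Pairs t => Pi.single q.1.1 1 + Pi.single q.1.2 1)
    (fun q v => S.sec (v q.1.1) (v q.1.2)) ?_
  · convert hcomp.isOpen.preimage (continuous_subtype_val (p := fun p => p ∈ domain t φ)) using 1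
    ext p
    have hne : ∀ q : Pairs t, S.sec (p.1 q.1.1).rep (p.1 q.1.2).rep ≠ 0 := fun q =>
      S.sec_ne_zero ((S.mem_domain_iff p.1).1 p.2 _ _ q.2).1
        ((S.mem_domain_iff p.1).1 p.2 _ _ q.2).2
    have := hg.rep_ne_zero_iff (fun q : Pairs t => S.sec (p.1 q.1.1).rep (p.1 q.1.2).rep) hne
    simp only [← eq_mk_of_mem (S.sec_mem_projMap hφ p _) (hne _)] at this
    exact this
  · intro q k
    have h1 := (IsForm.linear q.1.1 S.lam).mul
      (IsForm.linear q.1.2 (LinearMap.proj (R := ℂ) (φ := fun _ => ℂ) k ∘ₗ S.psi))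
    have h2 := (IsForm.linear q.1.2 S.lam).mul
      (IsForm.linear q.1.1 (LinearMap.proj (R := ℂ) (φ := fun _ => ℂ) k ∘ₗ S.psi))
    rw [add_comm (Pi.single q.1.2 1 : Fin t → ℕ)] at h2
    simpa [sec] using h1.sub h2

/-- The affine coordinates of a point outside of `R`. -/
noncomputable def aff (P : ℙ ℂ (Fin (n + 1 + 1) → ℂ)) : Fin (n + 1) → ℂ :=
  (S.lam P.rep)⁻¹ • S.psi P.rep

theorem lam_map_add (u : Fin (n + 1) → ℂ) : S.lam (φ u + S.e) = 1 := by
  rw [map_add, S.lam_map, S.lam_e, zero_add]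

theorem map_add_ne_zero (u : Fin (n + 1) → ℂ) : φ u + S.e ≠ 0 := fun h => by
  simpa [h] using S.lam_map_add u

/-- The point with given affine coordinates. -/
noncomputable def pt (u : Fin (n + 1) → ℂ) : ℙ ℂ (Fin (n + 1 + 1) → ℂ) :=
  Projectivization.mk ℂ (φ u + S.e) (S.map_add_ne_zero u)

theorem mem_pt (u : Fin (n + 1) → ℂ) : φ u + S.e ∈ (S.pt u).submodule :=
  mem_submodule_mk _

theorem lam_pt_ne_zero (u : Fin (n + 1) → ℂ) : S.lam (S.pt u).rep ≠ 0 := by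
  rw [← S.lam_ne_zero_iff_of_mem (S.mem_pt u) (S.map_add_ne_zero u), S.lam_map_add]
  exact one_ne_zero

theorem aff_pt (u : Fin (n + 1) → ℂ) : S.aff (S.pt u) = u := by
  obtain ⟨a, ha⟩ := exists_smul_eq (S.mem_pt u) (S.map_add_ne_zero u) (rep_mem (S.pt u))
  have h1 : S.lam (S.pt u).rep = a := by
    rw [ha, map_smul, S.lam_map_add, smul_eq_mul, mul_one]
  have ha0 : a ≠ 0 := h1 ▸ S.lam_pt_ne_zero u
  rw [aff, h1, ha, map_smul, map_add, S.psi_map, S.psi_e, add_zero, smul_smul,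
    inv_mul_cancel₀ ha0, one_smul]

theorem pt_aff {P : ℙ ℂ (Fin (n + 1 + 1) → ℂ)} (hP : S.lam P.rep ≠ 0) : S.pt (S.aff P) = P := by
  refine (eq_mk_of_mem ?_ _).symm
  have h := S.map_add_smul P.rep
  have : φ (S.aff P) + S.e = (S.lam P.rep)⁻¹ • P.rep := by
    rw [← inv_smul_eq_iff₀ (inv_ne_zero hP), inv_inv, aff, map_smul, smul_add,
      smul_inv_smul₀ hP, h]
  rw [this]
  exact Submodule.smul_mem _ _ (rep_mem P)

theorem pt_mem_domain {w : Fin t → Fin (n + 1) → ℂ} (hw : ∀ i j, i < j → w j - w i ≠ 0) :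
    (show MultiProj (Fin t) (n + 1) from fun i => S.pt (w i)) ∈ domain t φ := by
  refine (S.mem_domain_iff _).2 fun i j hij => ⟨fun h => hw i j hij ?_, Or.inl (S.lam_pt_ne_zero _)⟩
  rw [← S.aff_pt (w i), ← S.aff_pt (w j)]
  exact sub_eq_zero.2 (congrArg S.aff h.symm)

theorem sub_mem_projMap (hφ : Function.Injective φ) (p : domain t φ)
    (hp : ∀ i, S.lam (p.1 i).rep ≠ 0) (i j : Fin t) (h : i < j) :
    S.aff (p.1 j) - S.aff (p.1 i) ∈ (projMap φ hφ p (pr h)).submodule := by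
  rw [mem_projMap_iff]
  have : φ (S.aff (p.1 j) - S.aff (p.1 i)) =
      (φ (S.aff (p.1 j)) + S.e) - (φ (S.aff (p.1 i)) + S.e) := by
    rw [map_sub]
    module
  rw [this]
  refine Submodule.sub_mem _ (Submodule.mem_sup_right ?_) (Submodule.mem_sup_left ?_)
  · have := S.mem_pt (S.aff (p.1 j))
    rwa [S.pt_aff (hp j)] at this
  · have := S.mem_pt (S.aff (p.1 i))
    rwa [S.pt_aff (hp i)] at this

theorem isLift_projMap (hφ : Function.Injective φ) (p : domain t φ)
    (hp : ∀ i, S.lam (p.1 i).rep ≠ 0) :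
    IsLift (projMap φ hφ p) fun i => S.aff (p.1 i) := by
  refine fun i j h => ⟨S.sub_mem_projMap hφ p hp i j h, fun h0 => (p.2 i j h).1 ?_⟩
  have h1 : S.aff (p.1 j) = S.aff (p.1 i) := sub_eq_zero.1 h0
  rw [← S.pt_aff (hp i), ← S.pt_aff (hp j), h1]

/-- Every lift of a configuration defines a point of the fibre. -/
theorem exists_projMap_eq (hφ : Function.Injective φ) {x : MultiProj (Pairs t) n}
    {w : Fin t → Fin (n + 1) → ℂ} (hw : IsLift x w) :
    ∃ p : domain t φ, (∀ i, p.1 i = S.pt (w i)) ∧ projMap φ hφ p = x := by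
  let p : domain t φ := ⟨fun i => S.pt (w i), S.pt_mem_domain fun i j h => (hw i j h).2⟩
  refine ⟨p, fun i => rfl, ?_⟩
  funext ⟨⟨i, j⟩, h⟩
  have h1 := S.sub_mem_projMap hφ p (fun i => S.lam_pt_ne_zero _) i j h
  have h2 : ∀ i, S.aff (p.1 i) = w i := fun i => S.aff_pt (w i)
  rw [h2, h2] at h1
  exact eq_of_mem_of_mem h1 (hw i j h).1 (hw i j h).2

/-- If one of the points `p_i` is in `R`, then all the lines through it meet `R` there. -/
theorem lam_ne_zero_of_generic (hφ : Function.Injective φ) (ht : 3 ≤ t) (p : domain t φ)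
    (hp : projMap φ hφ p ∈ generic n t) (i : Fin t) : S.lam (p.1 i).rep ≠ 0 := by
  intro h0
  have hu := S.map_psi h0
  have hu0 : S.psi (p.1 i).rep ≠ 0 := fun h =>
    (p.1 i).rep_nonzero (by rw [← hu, h, map_zero])
  have hl : ∀ j (h : j < i), S.psi (p.1 i).rep ∈ (projMap φ hφ p (pr h)).submodule := fun j h => by
    rw [mem_projMap_iff, hu]
    exact Submodule.mem_sup_right (rep_mem _)
  have hr : ∀ j (h : i < j), S.psi (p.1 i).rep ∈ (projMap φ hφ p (pr h)).submodule := fun j h => by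
    rw [mem_projMap_iff, hu]
    exact Submodule.mem_sup_left (rep_mem _)
  obtain ⟨a, ha⟩ : ∃ a : Fin t, (a : ℕ) = 0 := ⟨⟨0, by omega⟩, rfl⟩
  obtain ⟨b, hb⟩ : ∃ b : Fin t, (b : ℕ) = 1 := ⟨⟨1, by omega⟩, rfl⟩
  obtain ⟨c, hc⟩ : ∃ c : Fin t, (c : ℕ) = 2 := ⟨⟨2, by omega⟩, rfl⟩
  have hab : a < b := Fin.lt_def.2 (by omega)
  have hbc : b < c := Fin.lt_def.2 (by omega)
  -- According to whether `i` is `0`, `1` or larger, it is the first, middle or last index of a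
  -- triple in which two points coincide.
  rcases eq_or_ne i a with rfl | hia
  · exact (hp.1 i b c hab hbc).1 (eq_of_mem_of_mem (hr b hab) (hr c (hab.trans hbc)) hu0)
  rcases eq_or_ne i b with rfl | hib
  · exact (hp.1 a i c hab hbc).2.1 (eq_of_mem_of_mem (hl a hab) (hr c hbc) hu0)
  have hbi : b < i := by
    have h1 : (i : ℕ) ≠ 0 := fun h => hia (Fin.ext (h.trans ha.symm))
    have h2 : (i : ℕ) ≠ 1 := fun h => hib (Fin.ext (h.trans hb.symm))
    exact Fin.lt_def.2 (by omega)
  exact (hp.1 a b i hab hbi).2.2 (eq_of_mem_of_mem (hl a (hab.trans hbi)) (hl b hbi) hu0)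

end Splitting

/-- Points of the moment curve are the lift of a generic configuration. -/
theorem exists_isLift_generic (hn : 2 ≤ n) :
    ∃ (x : MultiProj (Pairs t) n) (w : Fin t → Fin (n + 1) → ℂ), IsLift x w ∧ x ∈ generic n t := by
  let w : Fin t → Fin (n + 1) → ℂ := fun i k => (i : ℂ) ^ ((k : ℕ) + 1)
  have hcast : ∀ i j : Fin t, i ≠ j → (i : ℂ) - j ≠ 0 := fun i j hij h =>
    hij (Fin.ext (by exact_mod_cast sub_eq_zero.1 h))
  have h0 : ∀ i, w i ⟨0, by omega⟩ = (i : ℂ) := fun i => by simp [w]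
  have h1 : ∀ i, w i ⟨1, by omega⟩ = (i : ℂ) ^ 2 := fun i => by simp [w]
  have h2 : ∀ i, w i ⟨2, by omega⟩ = (i : ℂ) ^ 3 := fun i => by simp [w]
  have hw : ∀ i j : Fin t, i < j → w j - w i ≠ 0 := fun i j hij h => by
    refine hcast j i hij.ne' ?_
    rw [← h0, ← h0]
    exact congrFun h _
  let x : MultiProj (Pairs t) n := fun q => Projectivization.mk ℂ _ (hw q.1.1 q.1.2 q.2)
  have hx : IsLift x w := fun i j h => ⟨mem_submodule_mk _, hw i j h⟩
  -- The chord from `i` to `j` has slope `i + j` in the first two coordinates.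
  have hne : ∀ (i j k l : Fin t) (hij : i < j) (hkl : k < l), x (pr hij) = x (pr hkl) →
      (i : ℂ) + j = k + l := by
    intro i j k l hij hkl h
    have hm := (hx k l hkl).1
    rw [← h] at hm
    obtain ⟨s, hs⟩ := exists_smul_eq hm (hw k l hkl) (hx i j hij).1
    have e0 := congrFun hs ⟨0, by omega⟩
    have e1 := congrFun hs ⟨1, by omega⟩
    simp only [Pi.sub_apply, Pi.smul_apply, h0, h1, smul_eq_mul] at e0 e1
    refine mul_left_cancel₀ (hcast j i hij.ne') ?_
    linear_combination e1 - (k + l : ℂ) * e0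
  refine ⟨x, w, hx, ⟨fun a b c hab hbc => ⟨fun h => ?_, fun h => ?_, fun h => ?_⟩, ?_⟩⟩
  · exact hcast b c hbc.ne (by linear_combination hne _ _ _ _ _ _ h)
  · exact hcast a c (hab.trans hbc).ne (by linear_combination hne _ _ _ _ _ _ h)
  · exact hcast a b hab.ne (by linear_combination hne _ _ _ _ _ _ h)
  · intro a b c d hab hbc hcd
    have hac := hab.trans hbc
    have hbd := hbc.trans hcd
    have hpq : x (pr hab) ≠ x (pr hac) := fun h =>
      hcast b c hbc.ne (by linear_combination hne _ _ _ _ _ _ h)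
    rw [independent_triple_iff hpq, submodule_le_iff (hx b d hbd).1 (hx b d hbd).2,
      mem_join_iff (hx a b hab).1 (hx a b hab).2 (hx a c hac).1 (hx a c hac).2]
    rintro ⟨α, β, h⟩
    have e0 := congrFun h ⟨0, by omega⟩
    have e1 := congrFun h ⟨1, by omega⟩
    have e2 := congrFun h ⟨2, by omega⟩
    simp only [Pi.add_apply, Pi.sub_apply, Pi.smul_apply, h0, h1, h2, smul_eq_mul] at e0 e1 e2
    -- The cubic `(T - a)(T - b)(T - c)`, without its constant term, is a linear form on the curve.
    -- It kills the chords among `a, b, c` but takes the value `(d - a)(d - b)(d - c)` on the chord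
    -- from `b` to `d`.
    refine mul_ne_zero (mul_ne_zero (hcast d a (hac.trans hcd).ne') (hcast d b hbd.ne'))
      (hcast d c hcd.ne') ?_
    linear_combination (a + b + c : ℂ) * e1 - e2 - (a * b + b * c + c * a : ℂ) * e0

end Lift

/-! ### The chart on a fibre and the fibre dimension. -/

namespace Lift

open MvPolynomial

theorem exists_eval_eq_linear {σ : Type} [Fintype σ] [DecidableEq σ] (L : (σ → ℂ) →ₗ[ℂ] ℂ)
    (c : ℂ) : ∃ f : MvPolynomial σ ℂ, ∀ y, eval y f = L y + c := by
  refine ⟨(∑ j, C (L (Pi.single j 1)) * X j) + C c, fun y => ?_⟩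
  rw [LinearMap.pi_apply_eq_sum_univ L y]
  simp only [map_add, map_sum, map_mul, eval_C, eval_X, smul_eq_mul]
  congr 1
  refine Finset.sum_congr rfl fun j _ => ?_
  rw [mul_comm]
  congr 2
  ext k
  simp [Pi.single_apply, eq_comm]

/-- A polynomial in quotients of forms of the same multidegree becomes a form after clearing
denominators. -/
theorem exists_isForm_of_quotients {ι σ : Type} [Fintype ι] [DecidableEq ι] [Fintype σ] {m : ℕ}
    {δ : ι → ℕ} {A : σ → (ι → Fin (m + 1) → ℂ) → ℂ} {B : (ι → Fin (m + 1) → ℂ) → ℂ}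
    (hA : ∀ j, IsForm δ (A j)) (hB : IsForm δ B) (f : MvPolynomial σ ℂ) :
    ∃ d G, IsForm (m := m) d G ∧ ∀ v, B v ≠ 0 →
      (G v ≠ 0 ↔ eval (fun j => A j v / B v) f ≠ 0) := by
  let N : ℕ := f.support.sup fun s => ∑ j, s j
  have hN : ∀ s ∈ f.support, ∑ j, s j ≤ N := fun s hs =>
    Finset.le_sup (f := fun s : σ →₀ ℕ => ∑ j, s j) hs
  refine ⟨N • δ, fun v => ∑ s ∈ f.support, coeff s f * (B v ^ (N - ∑ j, s j) * ∏ j, A j v ^ s j),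
    IsForm.sum _ fun s hs => IsForm.const_mul _ ?_, fun v hv => ?_⟩
  · have := (hB.pow (N - ∑ j, s j)).mul (IsForm.prod Finset.univ fun j _ => (hA j).pow (s j))
    rwa [← Finset.sum_smul, ← add_smul, Nat.sub_add_cancel (hN s hs)] at this
  · have : (∑ s ∈ f.support, coeff s f * (B v ^ (N - ∑ j, s j) * ∏ j, A j v ^ s j)) =
        B v ^ N * eval (fun j => A j v / B v) f := by
      rw [eval_eq', Finset.mul_sum]
      refine Finset.sum_congr rfl fun s hs => ?_
      rw [mul_left_comm (B v ^ N)]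
      congr 1
      simp only [div_pow, Finset.prod_div_distrib, Finset.prod_pow_eq_pow_sum]
      rw [pow_sub₀ _ hv (hN s hs)]
      field_simp
    simp only [this]
    rw [mul_ne_zero_iff, and_iff_right (pow_ne_zero _ hv)]

variable {n t : ℕ} {φ : (Fin (n + 1) → ℂ) →ₗ[ℂ] (Fin (n + 1 + 1) → ℂ)}

namespace Splitting

variable (S : Splitting φ)

/-- Coordinates on a fibre: the scale, measured by a linear form `μ` on the difference of the
points with indices `o` and `l`, and the affine coordinates of the point with index `o`. -/
noncomputable def chart (μ : (Fin (n + 1) → ℂ) →ₗ[ℂ] ℂ) (o l : Fin t)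
    (p : MultiProj (Fin t) (n + 1)) : Fin (n + 1 + 1) → ℂ :=
  Fin.cons (μ (S.aff (p l) - S.aff (p o))) (S.aff (p o))

/-- The chart coordinates are quotients of forms with common denominator `lam (p o) * lam (p l)`.
This gives continuity of the chart. -/
theorem exists_isForm_chart (μ : (Fin (n + 1) → ℂ) →ₗ[ℂ] ℂ) (o l : Fin t)
    (f : MvPolynomial (Fin (n + 1 + 1)) ℂ) :
    ∃ d G, IsForm d G ∧ ∀ p : MultiProj (Fin t) (n + 1),
      S.lam (p o).rep ≠ 0 → S.lam (p l).rep ≠ 0 →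
      (G (fun i => (p i).rep) ≠ 0 ↔ eval (S.chart μ o l p) f ≠ 0) := by
  let A : Fin (n + 1 + 1) → (Fin t → Fin (n + 1 + 1) → ℂ) → ℂ := Fin.cons
    (fun v => S.lam (v o) * μ (S.psi (v l)) - μ (S.psi (v o)) * S.lam (v l))
    (fun k v => S.psi (v o) k * S.lam (v l))
  have hB := (IsForm.linear o S.lam).mul (IsForm.linear l S.lam)
  have hA : ∀ j, IsForm (Pi.single o 1 + Pi.single l 1) (A j) := by
    intro j
    refine Fin.cases ?_ (fun k => ?_) j
    · exact ((IsForm.linear o S.lam).mul (IsForm.linear l (μ ∘ₗ S.psi))).sub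
        ((IsForm.linear o (μ ∘ₗ S.psi)).mul (IsForm.linear l S.lam))
    · exact (IsForm.linear o (LinearMap.proj (R := ℂ) (φ := fun _ => ℂ) k ∘ₗ S.psi)).mul
        (IsForm.linear l S.lam)
  obtain ⟨d, G, hG, hGv⟩ := exists_isForm_of_quotients hA hB f
  refine ⟨d, G, hG, fun p ho hl => ?_⟩
  rw [hGv _ (mul_ne_zero ho hl)]
  have : (fun j => A j (fun i => (p i).rep) / (S.lam (p o).rep * S.lam (p l).rep)) =
      S.chart μ o l p := by
    funext j
    refine Fin.cases ?_ (fun k => ?_) j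
    · simp only [A, chart, Fin.cons_zero, aff, map_sub, map_smul, smul_eq_mul]
      field_simp
    · simp only [A, chart, Fin.cons_succ, aff, Pi.smul_apply, smul_eq_mul]
      field_simp
  rw [this]

/-- The vectors of the points of a fibre, as functions of the chart, are polynomial. -/
theorem exists_eval_eq_form {d : Fin t → ℕ} {g : (Fin t → Fin (n + 1 + 1) → ℂ) → ℂ}
    (hg : IsForm d g) (w : Fin t → Fin (n + 1) → ℂ) :
    ∃ f : MvPolynomial (Fin (n + 1 + 1)) ℂ, ∀ y,
      eval y f = g fun i => φ ((fun k => y (Fin.succ k)) + y 0 • w i) + S.e := by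
  obtain ⟨F, -, hF⟩ := hg
  have : ∀ a : Fin t × Fin (n + 1 + 1), ∃ f : MvPolynomial (Fin (n + 1 + 1)) ℂ, ∀ y,
      eval y f = (φ ((fun k => y (Fin.succ k)) + y 0 • w a.1) + S.e) a.2 := by
    intro a
    let T : (Fin (n + 1 + 1) → ℂ) →ₗ[ℂ] (Fin (n + 1) → ℂ) :=
      LinearMap.funLeft ℂ ℂ Fin.succ +
        (LinearMap.proj (R := ℂ) (φ := fun _ => ℂ) 0).smulRight (w a.1)
    obtain ⟨f, hf⟩ := exists_eval_eq_linear
      (LinearMap.proj (R := ℂ) (φ := fun _ => ℂ) a.2 ∘ₗ φ ∘ₗ T) (S.e a.2)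
    exact ⟨f, fun y => hf y⟩
  choose f hf using this
  refine ⟨aeval f F, fun y => ?_⟩
  rw [← hF, ← aeval_eq_eval, ← aeval_eq_eval, ← AlgHom.comp_apply, comp_aeval]
  congr 2
  funext a
  rw [← hf, aeval_eq_eval]

variable {x : MultiProj (Pairs t) n} {w : Fin t → Fin (n + 1) → ℂ}
  {μ : (Fin (n + 1) → ℂ) →ₗ[ℂ] ℂ}

/-- By uniqueness of lifts, the affine coordinates of `p` are a scaled translate of `w`. The
normalisations of `w` and `μ` let the chart read off the translation and the scale. -/
theorem aff_eq_of_chart (hφ : Function.Injective φ) (ht : 3 ≤ t) (hx : x ∈ generic n t)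
    (hw : IsLift x w) (hw0 : w ⟨0, by omega⟩ = 0) (hμ : μ (w ⟨1, by omega⟩) = 1)
    {p : domain t φ} (hp : projMap φ hφ p = x) :
    S.chart μ ⟨0, by omega⟩ ⟨1, by omega⟩ p.1 0 ≠ 0 ∧
    ∀ i, S.aff (p.1 i) = (fun k => S.chart μ ⟨0, by omega⟩ ⟨1, by omega⟩ p.1 (Fin.succ k)) +
      S.chart μ ⟨0, by omega⟩ ⟨1, by omega⟩ p.1 0 • w i := by
  have hlam := S.lam_ne_zero_of_generic hφ ht p (by rwa [hp])
  have hl := S.isLift_projMap hφ p hlam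
  rw [hp] at hl
  obtain ⟨c, hc0, hc⟩ := hw.exists_eq hx hl (by omega)
  rw [hw0] at hc
  have hc1 : S.chart μ ⟨0, by omega⟩ ⟨1, by omega⟩ p.1 0 = c := by
    rw [chart, Fin.cons_zero, hc, sub_zero, map_smul, hμ, smul_eq_mul, mul_one]
  rw [hc1]
  refine ⟨hc0, fun i => ?_⟩
  have h := hc i
  rw [sub_zero, sub_eq_iff_eq_add'] at h
  rw [h]
  rfl

/-- Polynomials in the chart become forms in the points, and conversely the points have vectors
polynomial in the chart. So both topologies have the same open sets. -/
theorem isInducing_chart (hφ : Function.Injective φ) (ht : 3 ≤ t) (hx : x ∈ generic n t)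
    (hw : IsLift x w) (hw0 : w ⟨0, by omega⟩ = 0) (hμ : μ (w ⟨1, by omega⟩) = 1) :
    Topology.IsInducing fun z : projMap (t := t) φ hφ ⁻¹' {x} =>
      pointToPoint (k := ℂ) (S.chart μ ⟨0, by omega⟩ ⟨1, by omega⟩ z.1.1) := by
  have hlam : ∀ (z : projMap (t := t) φ hφ ⁻¹' {x}) (i : Fin t), S.lam (z.1.1 i).rep ≠ 0 :=
    fun z => S.lam_ne_zero_of_generic hφ ht z.1 (by rw [z.2]; exact hx)
  have hcont : Continuous fun z : projMap (t := t) φ hφ ⁻¹' {x} => z.1.1 :=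
    continuous_subtype_val.comp continuous_subtype_val
  refine ⟨le_antisymm ?_ ?_⟩
  · rw [← continuous_iff_le_induced]
    refine PrimeSpectrum.isTopologicalBasis_basic_opens.continuous_iff.2 ?_
    rintro _ ⟨f, rfl⟩
    obtain ⟨d, G, hG, hGp⟩ := S.exists_isForm_chart μ (⟨0, by omega⟩ : Fin t) ⟨1, by omega⟩ f
    convert hG.isOpen.preimage hcont using 1
    ext z
    exact (pointToPoint_mem_basicOpen _ _).trans (hGp z.1.1 (hlam z _) (hlam z _)).symm
  · have : Topology.IsInducing fun z : projMap (t := t) φ hφ ⁻¹' {x} => z.1.1 :=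
      Topology.IsInducing.subtypeVal.comp Topology.IsInducing.subtypeVal
    rw [this.eq_induced, ← continuous_iff_le_induced]
    refine @continuous_of_isForm _ _ _ (TopologicalSpace.induced _ _) _ fun d g hg => ?_
    obtain ⟨f, hf⟩ := S.exists_eval_eq_form hg w
    refine isOpen_induced_iff.2 ⟨_, (PrimeSpectrum.basicOpen f).2, ?_⟩
    ext z
    refine (pointToPoint_mem_basicOpen _ _).trans ?_
    rw [hf]
    have hz := (S.aff_eq_of_chart hφ ht hx hw hw0 hμ z.2).2
    simp only [← hz]
    rw [← hg.rep_ne_zero_iff _ fun i => S.map_add_ne_zero _]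
    have : ∀ i, Projectivization.mk ℂ (φ (S.aff (z.1.1 i)) + S.e) (S.map_add_ne_zero _) = z.1.1 i :=
      fun i => S.pt_aff (hlam z i)
    simp only [this]
    exact Iff.rfl

theorem exists_chart_eq_iff (hφ : Function.Injective φ) (ht : 3 ≤ t) (hx : x ∈ generic n t)
    (hw : IsLift x w) (hw0 : w ⟨0, by omega⟩ = 0) (hμ : μ (w ⟨1, by omega⟩) = 1)
    (y : Fin (n + 1 + 1) → ℂ) :
    (∃ z : projMap (t := t) φ hφ ⁻¹' {x}, S.chart μ ⟨0, by omega⟩ ⟨1, by omega⟩ z.1.1 = y) ↔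
      y 0 ≠ 0 := by
  constructor
  · rintro ⟨z, rfl⟩
    exact (S.aff_eq_of_chart hφ ht hx hw hw0 hμ z.2).1
  · intro hy
    have hw' : IsLift x fun i => (fun k => y (Fin.succ k)) + y 0 • w i := by
      intro i j h
      have : (fun k => y (Fin.succ k)) + y 0 • w j - ((fun k => y (Fin.succ k)) + y 0 • w i) =
          y 0 • (w j - w i) := by module
      simp only [this]
      exact ⟨Submodule.smul_mem _ _ (hw i j h).1, smul_ne_zero hy (hw i j h).2⟩
    obtain ⟨p, hp, hpx⟩ := S.exists_projMap_eq hφ hw'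
    refine ⟨⟨p, hpx⟩, ?_⟩
    simp only [chart, hp, S.aff_pt, hw0, smul_zero, add_zero, add_sub_cancel_left, map_smul, hμ,
      smul_eq_mul, mul_one]
    exact Fin.cons_self_tail y

include S in
theorem topologicalKrullDim_fibre (hφ : Function.Injective φ) (ht : 3 ≤ t)
    (hxc : x ∈ configurations n t) (hx : x ∈ generic n t) :
    topologicalKrullDim ↥(projMap (t := t) φ hφ ⁻¹' {x}) = ((n + 2 : ℕ) : WithBot ℕ∞) := by
  obtain ⟨w, hw⟩ := exists_isLift hxc hx
  let o : Fin t := ⟨0, by omega⟩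
  let l : Fin t := ⟨1, by omega⟩
  have hw' : IsLift x fun i => w i - w o := fun i j h => by
    simpa only [sub_sub_sub_cancel_right] using hw i j h
  obtain ⟨k, hk⟩ := Function.ne_iff.1 (hw o l Nat.zero_lt_one).2
  -- The form `μ` is a coordinate that does not vanish on `w l - w o`, rescaled to take the value
  -- `1` there.
  have hμ : ((w l - w o) k)⁻¹ • LinearMap.proj (R := ℂ) (φ := fun _ => ℂ) k (w l - w o) = 1 :=
    inv_mul_cancel₀ hk
  exact topologicalKrullDim_of_isInducing
    (S.isInducing_chart hφ ht hx hw' (sub_self _)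
      (μ := ((w l - w o) k)⁻¹ • LinearMap.proj (R := ℂ) (φ := fun _ => ℂ) k) hμ)
    (S.exists_chart_eq_iff hφ ht hx hw' (sub_self _) hμ)

end Splitting

/-! ### Dominance, density and the image. -/

theorem configurations_inter_generic_subset_range (S : Splitting φ) (hφ : Function.Injective φ) :
    configurations n t ∩ generic n t ⊆ Set.range (projMap (t := t) φ hφ) := by
  rintro x ⟨hxc, hx⟩
  obtain ⟨w, hw⟩ := exists_isLift hxc hx
  obtain ⟨p, -, hp⟩ := S.exists_projMap_eq hφ hw
  exact ⟨p, hp⟩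

theorem dense_preimage_generic (S : Splitting φ) (hφ : Function.Injective φ) (hn : 2 ≤ n) :
    Dense (projMap (t := t) φ hφ ⁻¹' generic n t) := by
  obtain ⟨x, w, hw, hx⟩ := exists_isLift_generic (t := t) hn
  obtain ⟨p, -, hp⟩ := S.exists_projMap_eq hφ hw
  have : PreirreducibleSpace (domain t φ) := Subtype.preirreducibleSpace
    ((PreirreducibleSpace.isPreirreducible_univ (X := MultiProj (Fin t) (n + 1))).open_subset
      S.isOpen_domain (Set.subset_univ _))
  exact (isOpen_generic.preimage (S.continuous_projMap hφ)).dense ⟨p, by rwa [← hp] at hx⟩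

/-- Tuples with generic image are dense in the domain and map to generic configurations. By
continuity the remaining tuples map into the closure. -/
theorem range_projMap_subset_W (S : Splitting φ) (hφ : Function.Injective φ) (hn : 2 ≤ n)
    (ht : 3 ≤ t) : Set.range (projMap (t := t) φ hφ) ⊆ W n t := by
  refine ((S.continuous_projMap hφ).range_subset_closure_image_dense
    (dense_preimage_generic S hφ hn)).trans (closure_mono ?_)
  rw [configurations_inter_nondegenerate]
  rintro _ ⟨p, hp, rfl⟩
  exact ⟨(S.isLift_projMap hφ p (S.lam_ne_zero_of_generic hφ ht p hp)).mem_configurations, hp⟩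

theorem dense_domain (S : Splitting φ) (hφ : Function.Injective φ) (hn : 2 ≤ n) :
    Dense (domain t φ) := by
  obtain ⟨x, w, hw, -⟩ := exists_isLift_generic (t := t) hn
  obtain ⟨p, -, -⟩ := S.exists_projMap_eq hφ hw
  exact S.isOpen_domain.dense ⟨p.1, p.2⟩

end Lift

theorem mainTheorem3 (n t : ℕ) (hn : 2 ≤ n) (ht : 3 ≤ t)
    (φ : (Fin (n + 1) → ℂ) →ₗ[ℂ] (Fin (n + 1 + 1) → ℂ)) (hφ : Function.Injective φ) :
    -- `π` is a rational map from `(ℙ^(n+1))^t` to `W`: defined on a dense open set, values in `W`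
    (IsOpen (Lift.domain t φ) ∧ Dense (Lift.domain t φ) ∧
      Continuous (Lift.projMap (t := t) φ hφ) ∧
      Set.range (Lift.projMap (t := t) φ hφ) ⊆ Lift.W n t) ∧
    -- `π` is dominant
    Lift.W n t ⊆ closure (Set.range (Lift.projMap (t := t) φ hφ)) ∧
    -- the general fibre has dimension `n + 2`
    ∃ U : Set (Lift.MultiProj (Lift.Pairs t) n), IsOpen U ∧
      Lift.W n t ⊆ closure (U ∩ Lift.W n t) ∧
      ∀ x ∈ U ∩ Lift.W n t,
        topologicalKrullDim ↥(Lift.projMap (t := t) φ hφ ⁻¹' {x}) = ((n + 2 : ℕ) : WithBot ℕ∞) := by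
  obtain ⟨S⟩ := Lift.nonempty_splitting φ hφ
  have hW : Lift.W n t = closure (Lift.configurations n t ∩ Lift.generic n t) := by
    rw [Lift.W, Lift.configurations_inter_nondegenerate]
  refine ⟨⟨S.isOpen_domain, Lift.dense_domain S hφ hn, S.continuous_projMap hφ,
    Lift.range_projMap_subset_W S hφ hn ht⟩, ?_, Lift.generic n t, Lift.isOpen_generic, ?_, ?_⟩
  · rw [hW]
    exact closure_mono (Lift.configurations_inter_generic_subset_range S hφ)
  · conv_lhs => rw [hW]
    refine closure_mono fun x hx => ⟨hx.2, ?_⟩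
    rw [hW]
    exact subset_closure hx
  · exact fun x hx => S.topologicalKrullDim_fibre hφ ht (Lift.generic_inter_W_subset hx) hx.1
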